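/- **Setting.** Let $U$ be a measurable space (admissible controls), let $\phi=(\phi_1,\dots,\phi_J)^T$ and $\psi=(\psi_1,\dots,\psi_K)^T$ have measurable bounded components $U\to\mathbb R$, and let $\sigma_H,\sigma_T:U\to(0,\infty)$ be measurable, bounded, and bounded away from $0$; let $\gamma>0$. On a probability space $(\Omega,\mathcal F,\mathbb P)$ let $\alpha\sim N(\mu^\alpha_0,\Sigma^\alpha_0)$ in $\mathbb R^J$, $\beta\sim N(\mu^\beta_0,\Sigma^\beta_0)$ in $\mathbb R^K$ (with $\Sigma^\alpha_0,\Sigma^\beta_0$ symmetric positive definite) and standard normal $\epsilon_1,\epsilon_2,\dots,\eta_1,\eta_2,\dots$ be mutually independent. Put $H(u)=\alpha^T\phi(u)$, $T(u)=\beta^T\psi(u)$. For a sequence $(u_n)_{n\ge0}$ of $U$-valued random controls let, for $n\ge 0$, $$h_{n+1}=H(u_n)+\sigma_H(u_n)\epsilon_{n+1},\qquad t_{n+1}=T(u_n)+\sigma_T(u_n)\eta_{n+1},$$ $$\mathcal F_n=\sigma(h_1,\dots,h_n,t_1,\dots,t_n),\qquad \mathcal F_0=\{\emptyset,\Omega\}.$$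 A control is a sequence $(u_n)$ such that $u_n$ is $\mathcal F_n$-measurable for every $n\ge 0$. A pair $((u_n),\tau)$ is admissible if $(u_n)$ is a control and $\tau:\Omega\to\{1,2,\dots\}\cup\{\infty\}$ satisfies $\{\tau=n\}\in\mathcal F_n$ for all $n$. On $\{\tau=\infty\}$ the terminal rewards $H(u_{\tau-1})$ and $(\mu^\alpha_\tau)^T\phi(u_{\tau-1})$ below are read as $0$. For a control, define the Kalman filter by $$(\Sigma^\alpha_{n+1})^{-1}=(\Sigma^\alpha_n)^{-1}+\tfrac{1}{\sigma_H(u_n)^2}\phi(u_n)\phi(u_n)^T,\qquad \mu^\alpha_{n+1}=\mu^\alpha_n+\tfrac{1}{\sigma_H(u_n)^2}\Sigma^\alpha_{n+1}\phi(u_n)\bigl(h_{n+1}-\phi(u_n)^T\mu^\alpha_n\bigr),$$ and $(\mu^\beta_n,\Sigma^\beta_n)$ in the same way with $\psi,\sigma_T,t_{n+1}$ in place of $\phi,\sigma_H,h_{n+1}$. **Theorem (separation principle).** 1. The suprema over admissible pairs (in $[-\infty,\infty]$) agree: $$\sup_{(u_n),\tau}E\Bigl[H(u_{\tau-1})-\gamma\sum_{n=1}^{\tau}(t_n)^+\Bigr]=\sup_{(u_n),\tau}E\Bigl[(\mu^\alpha_\tau)^T\phi(u_{\tau-1})-\gamma\sum_{n=1}^{\tau}(t_n)^+\Bigr].$$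 2. In fact, for each admissible pair $((u_n),\tau)$ both random variables in brackets have a positive part with finite expectation, and their expectations (in $[-\infty,\infty)$) are equal. 3. For every control and every $n\ge 0$, the filter parameters $(\mu^\alpha_n,\Sigma^\alpha_n,\mu^\beta_n,\Sigma^\beta_n)$ are $\mathcal F_n$-measurable, $\Sigma^\alpha_n$ and $\Sigma^\beta_n$ are positive definite, and the conditional distribution of $(\alpha,\beta)$ given $\mathcal F_n$ is $N(\mu^\alpha_n,\Sigma^\alpha_n)\otimes N(\mu^\beta_n,\Sigma^\beta_n)$. 4. The second problem is a fully observed, time-homogeneous Markov decision problem in the filter parameters. Namely, for $x=(\mu^\alpha,\Sigma^\alpha,\mu^\beta,\Sigma^\beta)$ and $u\in U$ let $Q(x,u)$ be the law of $(x',t)$, where $$h\sim N\bigl((\mu^\alpha)^T\phi(u),\ \phi(u)^T\Sigma^\alpha\phi(u)+\sigma_H(u)^2\bigr),\qquad t\sim N\bigl((\mu^\beta)^T\psi(u),\ \psi(u)^T\Sigma^\beta\psi(u)+\sigma_T(u)^2\bigr)$$ are independent and $x'$ is the Kalman update of $x$ with control $u$ and observations $h,t$. (For arguments $x$ whose matrices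 are not positive definite, a negative variance is read as $0$ and the inverse of a singular matrix as $0$.) Then $Q$ is a stochastic kernel and, for every control and every $n\ge0$, the conditional distribution of $(\mu^\alpha_{n+1},\Sigma^\alpha_{n+1},\mu^\beta_{n+1},\Sigma^\beta_{n+1},t_{n+1})$ given $\mathcal F_n$ is $Q\bigl((\mu^\alpha_n,\Sigma^\alpha_n,\mu^\beta_n,\Sigma^\beta_n),u_n\bigr)$. -/

import Mathlib

open MeasureTheory ProbabilityTheory Matrix
open scoped ENNReal

namespace BCT

/-- The Borel (product) σ-algebra on `d × d` real matrices. -/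
instance matrixMeasurableSpace (d : ℕ) : MeasurableSpace (Matrix (Fin d) (Fin d) ℝ) :=
  inferInstanceAs (MeasurableSpace (Fin d → Fin d → ℝ))

/-- The data of the learning problem on the set `U` of admissible controls: basis functions,
observation error standard deviations, cost aversion, and the Gaussian priors of the coefficient
vectors, together with the standing assumptions on them. -/
structure Model (U : Type*) [MeasurableSpace U] (J K : ℕ) where
  /-- basis functions of the score -/
  phi : Fin J → U → ℝ
  /-- basis functions of the cost -/
  psi : Fin K → U → ℝ
  /-- standard deviation of the error in the observed score -/
  sigmaH : U → ℝ
  /-- standard deviation of the error in the observed cost -/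
  sigmaT : U → ℝ
  /-- aversion to computational cost -/
  gamma : ℝ
  /-- prior mean of the score coefficients -/
  muA : EuclideanSpace ℝ (Fin J)
  /-- prior covariance of the score coefficients -/
  SigmaA : Matrix (Fin J) (Fin J) ℝ
  /-- prior mean of the cost coefficients -/
  muB : EuclideanSpace ℝ (Fin K)
  /-- prior covariance of the cost coefficients -/
  SigmaB : Matrix (Fin K) (Fin K) ℝ
  measurable_phi : ∀ j, Measurable (phi j)
  measurable_psi : ∀ k, Measurable (psi k)
  measurable_sigmaH : Measurable sigmaH
  measurable_sigmaT : Measurable sigmaT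
  bounded_phi : ∃ C : ℝ, ∀ j u, |phi j u| ≤ C
  bounded_psi : ∃ C : ℝ, ∀ k u, |psi k u| ≤ C
  sigmaH_lower : ∃ c : ℝ, 0 < c ∧ ∀ u, c ≤ sigmaH u
  sigmaT_lower : ∃ c : ℝ, 0 < c ∧ ∀ u, c ≤ sigmaT u
  sigma_upper : ∃ C : ℝ, ∀ u, sigmaH u + sigmaT u ≤ C
  gamma_pos : 0 < gamma
  posDef_SigmaA : SigmaA.PosDef
  posDef_SigmaB : SigmaB.PosDef

/-- The random variables that drive the model: coefficient vectors `α`, `β` and observation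
errors. The errors of the `(n+1)`-st observation (`ε_{n+1}`, `η_{n+1}` in one-based numbering)
are `eps n` and `eta n`. -/
structure Noise (Ω : Type*) (J K : ℕ) where
  alpha : Ω → EuclideanSpace ℝ (Fin J)
  beta : Ω → EuclideanSpace ℝ (Fin K)
  eps : ℕ → Ω → ℝ
  eta : ℕ → Ω → ℝ

/-- The filter parameters `((μ^α, Σ^α), (μ^β, Σ^β))`. -/
abbrev FilterState (J K : ℕ) : Type :=
  (EuclideanSpace ℝ (Fin J) × Matrix (Fin J) (Fin J) ℝ) ×
    (EuclideanSpace ℝ (Fin K) × Matrix (Fin K) (Fin K) ℝ)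

noncomputable section

/-- One step of the Kalman filter for the linear observation `y = vᵀθ + s · N(0,1)` of a
Gaussian vector `θ` with mean `p.1` and covariance matrix `p.2`:
`Σ'⁻¹ = Σ⁻¹ + s⁻² v vᵀ` and `μ' = μ + s⁻² Σ' v (y - vᵀ μ)`. -/
def kalmanStep {d : ℕ} (v : Fin d → ℝ) (s y : ℝ)
    (p : EuclideanSpace ℝ (Fin d) × Matrix (Fin d) (Fin d) ℝ) :
    EuclideanSpace ℝ (Fin d) × Matrix (Fin d) (Fin d) ℝ :=
  let S : Matrix (Fin d) (Fin d) ℝ := (p.2⁻¹ + (1 / s ^ 2) • vecMulVec v v)⁻¹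
  (p.1 + WithLp.toLp 2 ((1 / s ^ 2 * (y - v ⬝ᵥ p.1.ofLp)) • (S *ᵥ v)), S)

/-- `(κ ω)` is a regular version of the conditional distribution of `X` given `m`, under `P`. -/
def IsCondLaw {Ω E : Type*} [MeasurableSpace Ω] [MeasurableSpace E] (P : Measure Ω)
    (m : MeasurableSpace Ω) (X : Ω → E) (κ : Ω → Measure E) : Prop :=
  ∀ A : Set E, MeasurableSet A →
    Measurable[m] (fun ω => κ ω A) ∧
    P[(X ⁻¹' A).indicator (fun _ => (1 : ℝ)) | m] =ᵐ[P] fun ω => (κ ω).real A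

/-- The expectation of an extended-real random variable, `E[Y⁺] - E[Y⁻]`
(meaningful when one of the two is finite). -/
def extExpectation {Ω : Type*} [MeasurableSpace Ω] (P : Measure Ω) (Y : Ω → EReal) : EReal :=
  ((∫⁻ ω, (Y ω).toENNReal ∂P : ℝ≥0∞) : EReal) - ((∫⁻ ω, (-Y ω).toENNReal ∂P : ℝ≥0∞) : EReal)

/-- The random variables have the prescribed distribution: `α` and `β` are Gaussian with the prior
parameters, the errors are standard normal, and `α`, `β`, `ε_1, ε_2, …`, `η_1, η_2, …` are
(mutually) independent. -/
structure Noise.IsDriving {Ω U : Type*} [MeasurableSpace Ω] [MeasurableSpace U] {J K : ℕ}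
    (N : Noise Ω J K) (M : Model U J K) (P : Measure Ω) : Prop where
  measurable_alpha : Measurable N.alpha
  measurable_beta : Measurable N.beta
  measurable_eps : ∀ n, Measurable (N.eps n)
  measurable_eta : ∀ n, Measurable (N.eta n)
  law_alpha : P.map N.alpha = multivariateGaussian M.muA M.SigmaA
  law_beta : P.map N.beta = multivariateGaussian M.muB M.SigmaB
  law_eps : ∀ n, P.map (N.eps n) = gaussianReal 0 1
  law_eta : ∀ n, P.map (N.eta n) = gaussianReal 0 1
  indep_alpha_beta : IndepFun N.alpha N.beta P
  indep_eps : iIndepFun N.eps P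
  indep_eta : iIndepFun N.eta P
  indep_eps_eta : IndepFun (fun ω n => N.eps n ω) (fun ω n => N.eta n ω) P
  indep_coeff_errors : IndepFun (fun ω => (N.alpha ω, N.beta ω))
    (fun ω => ((fun n => N.eps n ω), (fun n => N.eta n ω))) P

namespace Model

variable {Ω U : Type*} [MeasurableSpace U] {J K : ℕ}

/-- The vector `φ(u)`. -/
def phiVec (M : Model U J K) (u : U) : Fin J → ℝ := fun j => M.phi j u

/-- The vector `ψ(u)`. -/
def psiVec (M : Model U J K) (u : U) : Fin K → ℝ := fun k => M.psi k u

/-- The true expected score `H(u) = ∑ j, α_j φ_j(u)` for the coefficient vector `a`. -/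
def trueScore (M : Model U J K) (a : EuclideanSpace ℝ (Fin J)) (u : U) : ℝ :=
  ∑ j, a j * M.phi j u

/-- The true expected cost `T(u) = ∑ k, β_k ψ_k(u)` for the coefficient vector `b`. -/
def trueCost (M : Model U J K) (b : EuclideanSpace ℝ (Fin K)) (u : U) : ℝ :=
  ∑ k, b k * M.psi k u

/-- The observed score `h_{n+1} = H(u_n) + σ_H(u_n) ε_{n+1}` under the control process `u`. -/
def obsScore (M : Model U J K) (N : Noise Ω J K) (u : ℕ → Ω → U) (n : ℕ) (ω : Ω) : ℝ :=
  M.trueScore (N.alpha ω) (u n ω) + M.sigmaH (u n ω) * N.eps n ω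

/-- The observed cost `t_{n+1} = T(u_n) + σ_T(u_n) η_{n+1}` under the control process `u`. -/
def obsCost (M : Model U J K) (N : Noise Ω J K) (u : ℕ → Ω → U) (n : ℕ) (ω : Ω) : ℝ :=
  M.trueCost (N.beta ω) (u n ω) + M.sigmaT (u n ω) * N.eta n ω

/-- The observable history `𝓕_n = σ(h_1, …, h_n, t_1, …, t_n)`, trivial for `n = 0`. -/
def history (M : Model U J K) (N : Noise Ω J K) (u : ℕ → Ω → U) (n : ℕ) : MeasurableSpace Ω :=
  ⨆ i : Fin n, MeasurableSpace.comap (M.obsScore N u i) inferInstance ⊔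
    MeasurableSpace.comap (M.obsCost N u i) inferInstance

/-- The control process `u` is based on observations only: `u_n` is `𝓕_n`-measurable. -/
def IsControl (M : Model U J K) (N : Noise Ω J K) (u : ℕ → Ω → U) : Prop :=
  ∀ n, Measurable[M.history N u n] (u n)

/-- Admissible pairs: a control process and a stopping time `τ ≥ 1` of the observable history
(the value `∞`, never to stop, is allowed). -/
def IsAdmissible (M : Model U J K) (N : Noise Ω J K) (u : ℕ → Ω → U) (τ : Ω → ℕ∞) : Prop :=
  M.IsControl N u ∧ (∀ n : ℕ, MeasurableSet[M.history N u n] {ω | τ ω = (n : ℕ∞)}) ∧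
    ∀ ω, 1 ≤ τ ω

/-- The update of the filter parameters after the control `u` produced the observed score `h`
and the observed cost `t`. -/
def filterStep (M : Model U J K) (x : FilterState J K) (u : U) (h t : ℝ) : FilterState J K :=
  (kalmanStep (M.phiVec u) (M.sigmaH u) h x.1, kalmanStep (M.psiVec u) (M.sigmaT u) t x.2)

/-- The filter parameters `((μ^α_n, Σ^α_n), (μ^β_n, Σ^β_n))` along the control process `u`. -/
def filter (M : Model U J K) (N : Noise Ω J K) (u : ℕ → Ω → U) : ℕ → Ω → FilterState J K
  | 0, _ => ((M.muA, M.SigmaA), (M.muB, M.SigmaB))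
  | n + 1, ω => M.filterStep (filter M N u n ω) (u n ω) (M.obsScore N u n ω) (M.obsCost N u n ω)

/-- The distribution of the next filter parameters and the next observed cost when the current
filter parameters are `x` and the control `u` is used: the next score and cost are independent,
`N(μ^αᵀφ(u), φ(u)ᵀΣ^αφ(u) + σ_H(u)²)` and `N(μ^βᵀψ(u), ψ(u)ᵀΣ^βψ(u) + σ_T(u)²)` distributed, and
the filter parameters are updated by the Kalman filter. -/
def transition (M : Model U J K) (x : FilterState J K) (u : U) : Measure (FilterState J K × ℝ) :=
  ((gaussianReal (x.1.1.ofLp ⬝ᵥ M.phiVec u)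
      (M.phiVec u ⬝ᵥ (x.1.2 *ᵥ M.phiVec u) + M.sigmaH u ^ 2).toNNReal).prod
    (gaussianReal (x.2.1.ofLp ⬝ᵥ M.psiVec u)
      (M.psiVec u ⬝ᵥ (x.2.2 *ᵥ M.psiVec u) + M.sigmaT u ^ 2).toNNReal)).map
    (fun y => (M.filterStep x u y.1 y.2, y.2))

/-- The pay-off `R_τ - γ ∑_{n=1}^τ (t_n)⁺`, with the reward `R_n` replaced by `0` on `τ = ∞`. -/
def payoff (M : Model U J K) (N : Noise Ω J K) (u : ℕ → Ω → U) (τ : Ω → ℕ∞)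
    (R : ℕ → Ω → ℝ) (ω : Ω) : EReal :=
  ((if τ ω = ⊤ then 0 else R (τ ω).toNat ω : ℝ) : EReal) -
    ((ENNReal.ofReal M.gamma *
      ∑' n : ℕ, (if ((n + 1 : ℕ) : ℕ∞) ≤ τ ω then ENNReal.ofReal (M.obsCost N u n ω) else 0) :
        ℝ≥0∞) : EReal)

/-- The pay-off `H(u_{τ-1}) - γ ∑_{n=1}^τ (t_n)⁺` of the partially observed problem. -/
def truePayoff (M : Model U J K) (N : Noise Ω J K) (u : ℕ → Ω → U) (τ : Ω → ℕ∞) : Ω → EReal :=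
  M.payoff N u τ (fun n ω => M.trueScore (N.alpha ω) (u (n - 1) ω))

/-- The pay-off `(μ^α_τ)ᵀ φ(u_{τ-1}) - γ ∑_{n=1}^τ (t_n)⁺` of the fully observed problem. -/
def filteredPayoff (M : Model U J K) (N : Noise Ω J K) (u : ℕ → Ω → U) (τ : Ω → ℕ∞) :
    Ω → EReal :=
  M.payoff N u τ (fun n ω => (M.filter N u n ω).1.1.ofLp ⬝ᵥ M.phiVec (u (n - 1) ω))

/-- The optimal value of the partially observed problem. -/
def trueValue [MeasurableSpace Ω] (M : Model U J K) (N : Noise Ω J K) (P : Measure Ω) : EReal :=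
  ⨆ (u : ℕ → Ω → U) (τ : Ω → ℕ∞) (_ : M.IsAdmissible N u τ),
    extExpectation P (M.truePayoff N u τ)

/-- The optimal value of the fully observed problem. -/
def filteredValue [MeasurableSpace Ω] (M : Model U J K) (N : Noise Ω J K) (P : Measure Ω) :
    EReal :=
  ⨆ (u : ℕ → Ω → U) (τ : Ω → ℕ∞) (_ : M.IsAdmissible N u τ),
    extExpectation P (M.filteredPayoff N u τ)

end Model

end

end BCT

/-! ### Conditional laws as disintegrations, and Bayes' rule -/

namespace BCT

/-! The separation principle rests on one Bayesian fact and on the tower property.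

The Bayesian fact: given the history at time n, the coefficients (α, β) have the product Gaussian
law described by the filter. This is proved by induction on n. The next errors are independent of
the history and the coefficients together, and u_n is known from the history, so given the history
one faces a linear observation y = vᵀθ + s·e of a Gaussian θ with v and s fixed. Drawing θ and then
y gives the same joint law as drawing y from its predictive Gaussian and then θ from the Kalman
update (`map_observation_eq`). Characteristic functions show this by completing a square, once the
Sherman–Morrison formula has removed the matrix inverses. `lintegral_prod_bayes` runs the score and
cost blocks side by side, and `DisintegratesOver.bayes` carries the identity over to the random
history. It also yields the predictive law of the observations, whose image under the filter update
is the Markov kernel.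

The tower property: {τ = n} and u_{n-1} belong to the history at time n, and the posterior mean of
H(u) is the filter mean paired with φ(u). Hence both rewards have the same integral over {τ = n}.
Since |H(u)| ≤ C‖α‖ with ‖α‖ integrable, these identities may be summed over n, and {τ = ∞}
contributes 0. The cost is the same nonnegative variable in both problems. Subtracting it from an
integrable reward gives E[reward] − E[cost], even when the expected cost is infinite. The pay-offs
thus agree pair by pair, and so do the suprema.

Conditional laws are handled as disintegrations over sets of the history, which avoids null sets
until the final translation into conditional expectations. -/

/-- The family `κ` of measures disintegrates the law of `X` over the sets of the σ-algebra `m`. -/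
def DisintegratesOver {Ω E : Type*} [MeasurableSpace Ω] [MeasurableSpace E] (P : Measure Ω)
    (m : MeasurableSpace Ω) (X : Ω → E) (κ : Ω → Measure E) : Prop :=
  ∀ A : Set Ω, MeasurableSet[m] A → ∀ B : Set E, MeasurableSet B →
    P (A ∩ X ⁻¹' B) = ∫⁻ ω in A, κ ω B ∂P

theorem map_prodMk_eq_compProd {Ω S E : Type*} [MeasurableSpace Ω] [MeasurableSpace S]
    [MeasurableSpace E] {P : Measure Ω} [IsFiniteMeasure P] {Y : Ω → S} (hY : Measurable Y)
    {X : Ω → E} (hX : Measurable X) {κ : Kernel S E} [IsMarkovKernel κ]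
    (h : ∀ A : Set S, MeasurableSet A → ∀ B : Set E, MeasurableSet B →
      P (Y ⁻¹' A ∩ X ⁻¹' B) = ∫⁻ ω in Y ⁻¹' A, κ (Y ω) B ∂P) :
    P.map (fun ω => (Y ω, X ω)) = (P.map Y) ⊗ₘ κ := by
  refine Measure.ext_prod fun {A B} hA hB => ?_
  rw [Measure.map_apply (hY.prodMk hX) (hA.prod hB), Measure.compProd_apply_prod hA hB,
    setLIntegral_map hA (κ.measurable_coe hB) hY]
  exact h A hA B hB

/-- Rectangles determine the joint law of `Y` and `X`, so it is a composition product. The separate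
space `S` allows the choice `Y = id` from Ω with its full σ-algebra to Ω with the sub-σ-algebra `m`,
which is how every conditional statement is derived from this one. -/
theorem lintegral_eq_of_disintegrates {Ω S E : Type*} [MeasurableSpace Ω] [MeasurableSpace S]
    [MeasurableSpace E] {P : Measure Ω} [IsFiniteMeasure P] {Y : Ω → S} (hY : Measurable Y)
    {X : Ω → E} (hX : Measurable X) {κ : S → Measure E} (hκ : Measurable κ)
    [∀ s, IsProbabilityMeasure (κ s)]
    (h : ∀ A : Set S, MeasurableSet A → ∀ B : Set E, MeasurableSet B →
      P (Y ⁻¹' A ∩ X ⁻¹' B) = ∫⁻ ω in Y ⁻¹' A, κ (Y ω) B ∂P)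
    {f : S × E → ℝ≥0∞} (hf : Measurable f) :
    ∫⁻ ω, f (Y ω, X ω) ∂P = ∫⁻ ω, ∫⁻ x, f (Y ω, x) ∂κ (Y ω) ∂P := by
  let k : Kernel S E := ⟨κ, hκ⟩
  have : IsMarkovKernel k := ⟨fun s => inferInstanceAs (IsProbabilityMeasure (κ s))⟩
  have key := map_prodMk_eq_compProd hY hX (κ := k) h
  rw [← lintegral_map hf (hY.prodMk hX), key, Measure.lintegral_compProd hf,
    lintegral_map (hf.lintegral_kernel_prod_right' (κ := k)) hY]
  rfl

namespace DisintegratesOver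

variable {Ω E : Type*} {m mΩ : MeasurableSpace Ω} [MeasurableSpace E] {P : Measure Ω}
  {X : Ω → E} {κ : Ω → Measure E}

theorem of_lintegral_eq (hm : m ≤ mΩ) (hX : Measurable X)
    (h : ∀ f : Ω × E → ℝ≥0∞, Measurable[m.prod inferInstance] f →
      ∫⁻ ω, f (ω, X ω) ∂P = ∫⁻ ω, ∫⁻ x, f (ω, x) ∂κ ω ∂P) : DisintegratesOver P m X κ := by
  intro A hA B hB
  have hAB : MeasurableSet[m.prod inferInstance] (A ×ˢ B) :=
    hA.prod hB
  have := h ((A ×ˢ B).indicator fun _ => 1)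
    (measurable_const.indicator hAB)
  have e1 : ∀ ω x, (A ×ˢ B).indicator (fun _ => (1 : ℝ≥0∞)) (ω, x) =
      A.indicator (fun _ => B.indicator (fun _ => 1) x) ω := by
    intro ω x
    by_cases h1 : ω ∈ A <;> by_cases h2 : x ∈ B <;> simp [h1, h2]
  have e2 : ∀ ω, (A ×ˢ B).indicator (fun _ => (1 : ℝ≥0∞)) (ω, X ω) =
      (A ∩ X ⁻¹' B).indicator (fun _ => 1) ω := by
    intro ω
    by_cases h1 : ω ∈ A <;> by_cases h2 : X ω ∈ B <;> simp [h1, h2]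
  simp only [e2] at this
  rw [lintegral_indicator ((hm _ hA).inter (hX hB)), setLIntegral_const, one_mul] at this
  rw [this, ← lintegral_indicator (hm _ hA)]
  refine lintegral_congr fun ω => ?_
  simp only [e1]
  by_cases h1 : ω ∈ A <;> simp [h1, lintegral_indicator hB]

variable [IsFiniteMeasure P]

theorem lintegral_eq [∀ ω, IsProbabilityMeasure (κ ω)] (h : DisintegratesOver P m X κ) (hm : m ≤ mΩ)
    (hX : Measurable X) (hκ : Measurable[m] κ) {f : Ω × E → ℝ≥0∞}
    (hf : Measurable[m.prod inferInstance] f) :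
    ∫⁻ ω, f (ω, X ω) ∂P = ∫⁻ ω, ∫⁻ x, f (ω, x) ∂κ ω ∂P :=
  @lintegral_eq_of_disintegrates Ω Ω E mΩ m _ P _ id (measurable_id'' hm) X hX κ hκ _ h f hf

theorem isCondLaw [∀ ω, IsProbabilityMeasure (κ ω)] (h : DisintegratesOver P m X κ) (hm : m ≤ mΩ)
    (hX : Measurable X) (hκ : Measurable[m] κ) : IsCondLaw P m X κ := by
  intro A hA
  have h1 : Measurable[m] fun ω => κ ω A := (Measure.measurable_coe hA).comp hκ
  have h2 : Integrable (fun ω => (κ ω).real A) P := by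
    refine Integrable.of_bound (h1.mono hm le_rfl).ennreal_toReal.aestronglyMeasurable 1 ?_
    exact Filter.Eventually.of_forall fun ω => by
      rw [Real.norm_of_nonneg measureReal_nonneg]; exact measureReal_le_one
  refine ⟨h1, (ae_eq_condExp_of_forall_setIntegral_eq hm
    ((integrable_const _).indicator (hX hA)) (fun s _ _ => h2.integrableOn) ?_ ?_).symm⟩
  · intro s hs _
    have e1 : ∫ ω in s, (κ ω).real A ∂P = (∫⁻ ω in s, κ ω A ∂P).toReal :=
      integral_toReal (h1.mono hm le_rfl).aemeasurable
        (Filter.Eventually.of_forall fun ω => measure_lt_top _ _)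
    rw [e1, ← h s hs A hA, integral_indicator (hX hA), setIntegral_const, smul_eq_mul, mul_one,
      measureReal_restrict_apply (hX hA), Set.inter_comm]
    rfl
  · exact h1.ennreal_toReal.stronglyMeasurable.aestronglyMeasurable

theorem map {F : Type*} [MeasurableSpace F] [∀ ω, IsProbabilityMeasure (κ ω)]
    (h : DisintegratesOver P m X κ) (hm : m ≤ mΩ)
    (hX : Measurable X) (hκ : Measurable[m] κ) {g : Ω × E → F}
    (hg : Measurable[m.prod inferInstance] g) {κ' : Ω → Measure F}
    (hκ' : ∀ ω, κ' ω = (κ ω).map fun x => g (ω, x)) :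
    DisintegratesOver P m (fun ω => g (ω, X ω)) κ' := by
  intro A hA B hB
  have hAB : MeasurableSet[m.prod inferInstance] (Prod.fst ⁻¹' A ∩ g ⁻¹' B) :=
    MeasurableSet.inter (measurable_fst hA) (hg hB)
  have hgω : ∀ ω, Measurable fun x => g (ω, x) := fun ω =>
    hg.comp measurable_prodMk_left
  have hgX : Measurable fun ω => g (ω, X ω) :=
    hg.comp ((measurable_id'' hm).prodMk hX)
  have := h.lintegral_eq hm hX hκ (f := (Prod.fst ⁻¹' A ∩ g ⁻¹' B).indicator fun _ => 1)
    (measurable_const.indicator hAB)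
  have e1 : ∀ ω x, (Prod.fst ⁻¹' A ∩ g ⁻¹' B).indicator (fun _ => (1 : ℝ≥0∞)) (ω, x) =
      A.indicator (fun _ => ((fun y => g (ω, y)) ⁻¹' B).indicator (fun _ => 1) x) ω := by
    intro ω x
    by_cases h1 : ω ∈ A <;> by_cases h2 : g (ω, x) ∈ B <;> simp [h1, h2]
  have e2 : ∀ ω, (Prod.fst ⁻¹' A ∩ g ⁻¹' B).indicator (fun _ => (1 : ℝ≥0∞)) (ω, X ω) =
      (A ∩ (fun ω => g (ω, X ω)) ⁻¹' B).indicator (fun _ => 1) ω := by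
    intro ω
    by_cases h1 : ω ∈ A <;> by_cases h2 : g (ω, X ω) ∈ B <;> simp [h1, h2]
  simp only [e2] at this
  rw [lintegral_indicator ((hm _ hA).inter (hgX hB)), setLIntegral_const, one_mul] at this
  rw [this, ← lintegral_indicator (hm _ hA)]
  refine lintegral_congr fun ω => ?_
  simp only [e1]
  by_cases h1 : ω ∈ A
  · simp [h1, lintegral_indicator (hgω ω hB), hκ', Measure.map_apply (hgω ω) hB]
  · simp [h1]

end DisintegratesOver

/-- Every event known from `m` and `w` thus has the form {(ω, w ω) ∈ D} with `D` measurable in the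
product, so the passage to a richer history needs no generating class argument. -/
theorem sup_comap_eq_comap_prodMk {Ω F : Type*} (m : MeasurableSpace Ω) [mF : MeasurableSpace F]
    (w : Ω → F) :
    m ⊔ mF.comap w = (m.prod mF).comap fun ω => (ω, w ω) := by
  rw [MeasurableSpace.prod, MeasurableSpace.comap_sup, MeasurableSpace.comap_comp,
    MeasurableSpace.comap_comp]
  congr 1
  exact MeasurableSpace.comap_id.symm

/-- Bayes' rule: if `θ` has the conditional law `κ` given `m`, the error `ξ` with law `ν` is
independent of `m` and `θ`, and the joint law of the observation `g (ω, ·)` and `θ` disintegrates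
into `ρ ω` and `κ' (ω, ·)`, then the observation has the conditional law `ρ` given `m`, and `κ'` is
the conditional law of `θ` given `m` and the observation. -/
theorem DisintegratesOver.bayes {Ω E Ξ W : Type*} {m mΩ : MeasurableSpace Ω} [MeasurableSpace E]
    [MeasurableSpace Ξ] [MeasurableSpace W] {P : Measure Ω} [IsProbabilityMeasure P]
    (hm : m ≤ mΩ) {θ : Ω → E} (hθ : Measurable θ) {ξ : Ω → Ξ}
    (hξ : Measurable ξ) {κ : Ω → Measure E} [∀ ω, IsProbabilityMeasure (κ ω)]
    (hκ : Measurable[m] κ) (hκθ : DisintegratesOver P m θ κ)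
    {ν : Measure Ξ} [IsProbabilityMeasure ν]
    (hνξ : DisintegratesOver P (m ⊔ MeasurableSpace.comap θ inferInstance) ξ fun _ => ν)
    {g : Ω × (E × Ξ) → W} (hg : Measurable[m.prod inferInstance] g)
    {ρ : Ω → Measure W} [∀ ω, IsProbabilityMeasure (ρ ω)] (hρ : Measurable[m] ρ)
    {κ' : Ω × W → Measure E} [∀ p, IsProbabilityMeasure (κ' p)]
    (hκ' : Measurable[m.prod inferInstance] κ')
    (key : ∀ ω, ∀ F : W × E → ℝ≥0∞, Measurable F →
      ∫⁻ x, ∫⁻ e, F (g (ω, (x, e)), x) ∂ν ∂κ ω = ∫⁻ w, ∫⁻ x, F (w, x) ∂κ' (ω, w) ∂ρ ω) :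
    DisintegratesOver P m (fun ω => g (ω, (θ ω, ξ ω))) ρ ∧
    DisintegratesOver P
      (m ⊔ MeasurableSpace.comap (fun ω => g (ω, (θ ω, ξ ω))) inferInstance) θ
      (fun ω => κ' (ω, g (ω, (θ ω, ξ ω)))) := by
  set w : Ω → W := fun ω => g (ω, (θ ω, ξ ω)) with hw_def
  have hw : Measurable w :=
    hg.comp ((measurable_id'' hm).prodMk (hθ.prodMk hξ))
  have hmθ : m ⊔ MeasurableSpace.comap θ inferInstance ≤ mΩ := sup_le hm hθ.comap_le
  -- the conditional expectation of a function of `θ` and `ξ`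
  have joint : ∀ G : Ω × (E × Ξ) → ℝ≥0∞, Measurable[m.prod inferInstance] G →
      ∫⁻ ω, G (ω, (θ ω, ξ ω)) ∂P = ∫⁻ ω, ∫⁻ x, ∫⁻ e, G (ω, (x, e)) ∂ν ∂κ ω ∂P := by
    intro G hG
    have h1 := hνξ.lintegral_eq hmθ hξ measurable_const (f := fun p => G (p.1, (θ p.1, p.2))) (by
      refine hG.comp (Measurable.prodMk ?_ ?_)
      · exact measurable_fst.mono le_rfl le_sup_left
      · refine Measurable.prodMk ?_ ?_
        · have h2 : Measurable[m ⊔ MeasurableSpace.comap θ inferInstance] θ :=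
            (comap_measurable θ).mono le_sup_right le_rfl
          exact h2.comp measurable_fst
        · exact measurable_snd)
    rw [h1]
    refine hκθ.lintegral_eq hm hθ hκ (f := fun p => ∫⁻ e, G (p.1, (p.2, e)) ∂ν) ?_
    refine @Measurable.lintegral_prod_right' (Ω × E) Ξ (m.prod inferInstance) _ ν _
      (fun q => G (q.1.1, (q.1.2, q.2))) ?_
    exact hG.comp ((measurable_fst.comp measurable_fst).prodMk
      ((measurable_snd.comp measurable_fst).prodMk measurable_snd))
  -- The same expectation with the sampling order reversed: for frozen ω, `key` draws the
  -- observation from `ρ` first and then `θ` from `κ'`. Both conclusions are special cases.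
  have obs : ∀ G : (Ω × W) × E → ℝ≥0∞, Measurable[(m.prod inferInstance).prod inferInstance] G →
      ∫⁻ ω, G ((ω, w ω), θ ω) ∂P =
        ∫⁻ ω, ∫⁻ y, ∫⁻ x, G ((ω, y), x) ∂κ' (ω, y) ∂ρ ω ∂P := by
    intro G hG
    rw [joint (fun q => G ((q.1, g q), q.2.1)) (by
      refine hG.comp (Measurable.prodMk ?_ ?_)
      · exact measurable_fst.prodMk hg
      · exact measurable_fst.comp measurable_snd)]
    refine lintegral_congr fun ω => ?_
    refine key ω (fun q => G ((ω, q.1), q.2)) ?_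
    refine hG.comp (Measurable.prodMk ?_ measurable_snd)
    exact measurable_prodMk_left.comp measurable_fst
  have obs' : DisintegratesOver P m w ρ := by
    refine DisintegratesOver.of_lintegral_eq hm hw fun f hf => ?_
    have := obs (fun q => f q.1) (hf.comp measurable_fst)
    simpa using this
  refine ⟨obs', ?_⟩
  intro A hA B hB
  rw [sup_comap_eq_comap_prodMk] at hA
  obtain ⟨D, hD, rfl⟩ := hA
  have hDm : MeasurableSet ((fun ω => (ω, w ω)) ⁻¹' D) :=
    ((measurable_id'' hm).prodMk hw) hD
  have hk : Measurable[m.prod inferInstance] fun q : Ω × W => κ' q B :=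
    (Measure.measurable_coe hB).comp hκ'
  have h1 := obs (fun q => D.indicator (fun _ => B.indicator (fun _ => 1) q.2) q.1) (by
    have : (fun q : (Ω × W) × E => D.indicator (fun _ => B.indicator (fun _ => (1 : ℝ≥0∞)) q.2) q.1)
        = (D ×ˢ B).indicator fun _ => 1 := by
      ext q
      by_cases h1 : q.1 ∈ D <;> by_cases h2 : q.2 ∈ B <;> simp [h1, h2, Set.mem_prod]
    rw [this]
    exact measurable_const.indicator (hD.prod hB))
  have h2 := obs'.lintegral_eq hm hw hρ (f := D.indicator fun q => κ' q B)
    (hk.indicator hD)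
  have e1 : P ((fun ω => (ω, w ω)) ⁻¹' D ∩ θ ⁻¹' B) =
      ∫⁻ ω, D.indicator (fun _ => B.indicator (fun _ => 1) (θ ω)) (ω, w ω) ∂P := by
    rw [← lintegral_indicator_one (hDm.inter (hθ hB))]
    refine lintegral_congr fun ω => ?_
    by_cases h1 : (ω, w ω) ∈ D <;> by_cases h2 : θ ω ∈ B <;> simp [h1, h2]
  rw [e1, h1, ← lintegral_indicator hDm]
  refine Eq.trans ?_ (h2.symm.trans ?_)
  · refine lintegral_congr fun ω => lintegral_congr fun y => ?_
    by_cases h1 : (ω, y) ∈ D <;> simp [h1, lintegral_indicator hB]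
  · refine lintegral_congr fun ω => ?_
    by_cases h1 : (ω, w ω) ∈ D <;> simp [h1, w]

end BCT

/-! ### One Kalman step as Bayes' rule for a Gaussian vector -/

namespace BCT

variable {d : ℕ}

theorem posDef_kalmanStep (v : Fin d → ℝ) (s y : ℝ)
    {p : EuclideanSpace ℝ (Fin d) × Matrix (Fin d) (Fin d) ℝ} (hp : p.2.PosDef) :
    (kalmanStep v s y p).2.PosDef := by
  refine (hp.inv.add_posSemidef ?_).inv
  have h := posSemidef_vecMulVec_self_star v
  rw [star_trivial] at h
  exact h.smul (by positivity)

theorem obsVariance_pos (v : Fin d → ℝ) {s : ℝ} (hs : 0 < s) {S : Matrix (Fin d) (Fin d) ℝ}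
    (hS : S.PosDef) : 0 < v ⬝ᵥ (S *ᵥ v) + s ^ 2 := by
  have := hS.posSemidef.dotProduct_mulVec_nonneg v
  rw [star_trivial] at this
  positivity

/-- The Sherman–Morrison formula for the covariance update of the Kalman filter. -/
theorem kalmanStep_snd_eq (v : Fin d → ℝ) {s : ℝ} (hs : 0 < s) (y : ℝ)
    {p : EuclideanSpace ℝ (Fin d) × Matrix (Fin d) (Fin d) ℝ} (hp : p.2.PosDef) :
    (kalmanStep v s y p).2 = p.2 -
      (1 / (v ⬝ᵥ (p.2 *ᵥ v) + s ^ 2)) • vecMulVec (p.2 *ᵥ v) (p.2 *ᵥ v) := by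
  obtain ⟨μ, S⟩ := p
  simp only at hp ⊢
  have hV := obsVariance_pos v hs hp
  set a := S *ᵥ v with ha
  set V := v ⬝ᵥ a + s ^ 2 with hVdef
  have hunit : IsUnit S.det := (Matrix.isUnit_iff_isUnit_det S).1 hp.isUnit
  have hsymm : v ᵥ* S = a := by
    have : Sᵀ = S := by simpa [Matrix.conjTranspose_eq_transpose_of_trivial] using hp.isHermitian.eq
    rw [ha, ← Matrix.vecMul_transpose, this]
  have hinv : S⁻¹ *ᵥ a = v := by
    rw [ha, Matrix.mulVec_mulVec, Matrix.nonsing_inv_mul _ hunit, Matrix.one_mulVec]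
  show (S⁻¹ + (1 / s ^ 2) • vecMulVec v v)⁻¹ = _
  refine Matrix.inv_eq_right_inv ?_
  rw [Matrix.add_mul, Matrix.mul_sub, Matrix.mul_sub, Matrix.nonsing_inv_mul _ hunit,
    Matrix.mul_smul, Matrix.mul_smul, Matrix.mul_vecMulVec, hinv, Matrix.smul_mul, Matrix.smul_mul,
    Matrix.vecMulVec_mul, hsymm, Matrix.vecMulVec_mul_vecMulVec]
  -- The product to be compared with 1 is 1 plus a multiple of v aᵀ. Its coefficient s⁻² − V⁻¹ −
  -- s⁻²V⁻¹(vᵀa) vanishes because vᵀa = V − s².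
  have hva : v ⬝ᵥ a = V - s ^ 2 := by rw [hVdef]; ring
  rw [hva, sub_add, sub_eq_self, Matrix.vecMulVec_smul, smul_smul, smul_smul, ← sub_smul, ← sub_smul]
  convert zero_smul ℝ (vecMulVec v a) using 2
  field_simp
  ring

/-- Sherman–Morrison gives Σ'v = (s²/V) Σv, so the gain s⁻²Σ'v equals Σv/V. In this form the new
mean is visibly affine in the observation. -/
theorem kalmanStep_fst_eq (v : Fin d → ℝ) {s : ℝ} (hs : 0 < s) (y : ℝ)
    {p : EuclideanSpace ℝ (Fin d) × Matrix (Fin d) (Fin d) ℝ} (hp : p.2.PosDef) :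
    (kalmanStep v s y p).1 = p.1 + WithLp.toLp 2
      (((y - v ⬝ᵥ p.1.ofLp) / (v ⬝ᵥ (p.2 *ᵥ v) + s ^ 2)) • (p.2 *ᵥ v)) := by
  have hV := obsVariance_pos v hs hp
  have h1 : (kalmanStep v s y p).1 = p.1 + WithLp.toLp 2
      ((1 / s ^ 2 * (y - v ⬝ᵥ p.1.ofLp)) • ((kalmanStep v s y p).2 *ᵥ v)) := rfl
  rw [h1, kalmanStep_snd_eq v hs y hp, Matrix.sub_mulVec, Matrix.smul_mulVec,
    Matrix.vecMulVec_mulVec]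
  congr 2
  ext i
  have : (p.2 *ᵥ v) ⬝ᵥ v = v ⬝ᵥ (p.2 *ᵥ v) := dotProduct_comm _ _
  simp only [Pi.smul_apply, Pi.sub_apply, smul_eq_mul, MulOpposite.smul_eq_mul_unop,
    MulOpposite.unop_op, this]
  field_simp
  ring

theorem lintegral_multivariateGaussian (μ : EuclideanSpace ℝ (Fin d)) (S : Matrix (Fin d) (Fin d) ℝ)
    {F : EuclideanSpace ℝ (Fin d) → ℝ≥0∞} (hF : Measurable F) :
    ∫⁻ x, F x ∂multivariateGaussian μ S = ∫⁻ z, F (μ + z) ∂multivariateGaussian 0 S := by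
  have : multivariateGaussian μ S = (multivariateGaussian 0 S).map (fun z => μ + z) := by
    rw [multivariateGaussian, multivariateGaussian, Measure.map_map (by fun_prop) (by fun_prop)]
    congr 1
    ext x
    simp
  rw [this, lintegral_map hF (by fun_prop)]

theorem integral_exp_dotProduct_multivariateGaussian (t : Fin d → ℝ) (μ : EuclideanSpace ℝ (Fin d))
    {S : Matrix (Fin d) (Fin d) ℝ} (hS : S.PosSemidef) :
    ∫ x, Complex.exp ((t ⬝ᵥ x.ofLp : ℝ) * Complex.I) ∂multivariateGaussian μ S =
      Complex.exp ((t ⬝ᵥ μ.ofLp : ℝ) * Complex.I - (t ⬝ᵥ (S *ᵥ t) : ℝ) / 2) := by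
  have h := charFun_multivariateGaussian (μ := μ) hS (WithLp.toLp 2 t)
  rw [charFun_apply] at h
  have e1 : ∀ x : EuclideanSpace ℝ (Fin d), inner ℝ x (WithLp.toLp 2 t) = t ⬝ᵥ x.ofLp := fun x => by
    rw [EuclideanSpace.inner_eq_star_dotProduct, star_trivial]
  rw [real_inner_comm, e1] at h
  simpa only [e1] using h

theorem integral_exp_mul_gaussianReal (a m : ℝ) {V : ℝ} (hV : 0 ≤ V) :
    ∫ e, Complex.exp ((a * e : ℝ) * Complex.I) ∂gaussianReal m V.toNNReal =
      Complex.exp ((a * m : ℝ) * Complex.I - (V * a ^ 2 : ℝ) / 2) := by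
  have h := charFun_gaussianReal (μ := m) (v := V.toNNReal) a
  rw [charFun_apply_real] at h
  simpa [hV] using h

/-- The residual of θ after subtracting the updated mean is Gaussian and independent of y. The
updated covariance does not involve y, so the dummy observation 0 may stand in for it. Both sides
are compared through their characteristic functionals. -/
theorem map_observation_eq (v : Fin d → ℝ) {s : ℝ} (hs : 0 < s)
    {p : EuclideanSpace ℝ (Fin d) × Matrix (Fin d) (Fin d) ℝ} (hp : p.2.PosDef) :
    ((multivariateGaussian p.1 p.2).prod (gaussianReal 0 1)).map
        (fun q => (v ⬝ᵥ q.1.ofLp + s * q.2, q.1)) =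
      ((gaussianReal (p.1.ofLp ⬝ᵥ v) (v ⬝ᵥ (p.2 *ᵥ v) + s ^ 2).toNNReal).prod
        (multivariateGaussian 0 (kalmanStep v s 0 p).2)).map
        (fun q => (q.1, (kalmanStep v s q.1 p).1 + q.2)) := by
  have hV := obsVariance_pos v hs hp
  have hm1 : Measurable fun q : EuclideanSpace ℝ (Fin d) × ℝ => (v ⬝ᵥ q.1.ofLp + s * q.2, q.1) := by
    unfold dotProduct; fun_prop
  simp only [kalmanStep_fst_eq v hs _ hp]
  have hm2 : Measurable fun q : ℝ × EuclideanSpace ℝ (Fin d) => (q.1, p.1 + WithLp.toLp 2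
      (((q.1 - v ⬝ᵥ p.1.ofLp) / (v ⬝ᵥ (p.2 *ᵥ v) + s ^ 2)) • (p.2 *ᵥ v)) + q.2) := by
    fun_prop
  have := Measure.isProbabilityMeasure_map (μ := (multivariateGaussian p.1 p.2).prod (gaussianReal 0 1)) hm1.aemeasurable
  have := Measure.isProbabilityMeasure_map (μ := (gaussianReal (p.1.ofLp ⬝ᵥ v) (v ⬝ᵥ (p.2 *ᵥ v) + s ^ 2).toNNReal).prod
        (multivariateGaussian 0 (kalmanStep v s 0 p).2)) hm2.aemeasurable
  refine Measure.ext_of_charFunDual ?_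
  ext L
  rw [charFunDual_apply, charFunDual_apply, integral_map hm1.aemeasurable (by fun_prop),
    integral_map hm2.aemeasurable (by fun_prop)]
  set r : ℝ := L (1, 0)
  -- A functional on ℝ × E is a scalar r on the observation and, by Riesz, a vector k on the
  -- coefficients.
  set k : EuclideanSpace ℝ (Fin d) := (InnerProductSpace.toDual ℝ _).symm
    (L.comp (ContinuousLinearMap.inr ℝ ℝ _)) with hk
  have hL : ∀ y x, L (y, x) = r * y + k.ofLp ⬝ᵥ x.ofLp := by
    intro y x
    have h1 : (y, x) = y • ((1 : ℝ), (0 : EuclideanSpace ℝ (Fin d))) + (0, x) := by simp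
    have h2 : L (0, x) = inner ℝ k x := by
      rw [hk, InnerProductSpace.toDual_symm_apply]; rfl
    rw [h1, map_add, map_smul, h2, EuclideanSpace.inner_eq_star_dotProduct, star_trivial,
      dotProduct_comm, smul_eq_mul, mul_comm]
  simp only [hL]
  have hS : p.2 = p.2ᵀ := by
    simpa [Matrix.conjTranspose_eq_transpose_of_trivial] using hp.isHermitian.eq.symm
  set a := p.2 *ᵥ v with ha
  set V := v ⬝ᵥ a + s ^ 2 with hVdef
  set t := k.ofLp with ht
  set m := p.1.ofLp with hm
  have hsymm : v ⬝ᵥ (p.2 *ᵥ t) = t ⬝ᵥ a := by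
    rw [ha, Matrix.dotProduct_mulVec, Matrix.dotProduct_mulVec, ← Matrix.mulVec_transpose, ← hS,
      dotProduct_comm, Matrix.dotProduct_mulVec]
  have e1 : ∀ q : EuclideanSpace ℝ (Fin d) × ℝ,
      Complex.exp ((r * (v ⬝ᵥ q.1.ofLp + s * q.2) + t ⬝ᵥ q.1.ofLp : ℝ) * Complex.I) =
        Complex.exp (((r • v + t) ⬝ᵥ q.1.ofLp : ℝ) * Complex.I) *
          Complex.exp ((r * s * q.2 : ℝ) * Complex.I) := by
    intro q
    rw [← Complex.exp_add, add_dotProduct, smul_dotProduct, smul_eq_mul]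
    congr 1
    push_cast
    ring
  have e2 : ∀ q : ℝ × EuclideanSpace ℝ (Fin d),
      Complex.exp ((r * q.1 + t ⬝ᵥ (p.1 + WithLp.toLp 2 (((q.1 - v ⬝ᵥ m) / V) • a) + q.2).ofLp : ℝ)
          * Complex.I) =
        Complex.exp ((t ⬝ᵥ m - (t ⬝ᵥ a) / V * (v ⬝ᵥ m) : ℝ) * Complex.I) *
          (Complex.exp (((r + (t ⬝ᵥ a) / V) * q.1 : ℝ) * Complex.I) *
          Complex.exp ((t ⬝ᵥ q.2.ofLp : ℝ) * Complex.I)) := by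
    intro q
    rw [← Complex.exp_add, ← Complex.exp_add, WithLp.ofLp_add, WithLp.ofLp_add, dotProduct_add,
      dotProduct_add, dotProduct_smul, smul_eq_mul]
    congr 1
    push_cast
    ring
  simp only [e1, e2]
  rw [integral_const_mul,
    integral_prod_mul
      (fun x : EuclideanSpace ℝ (Fin d) =>
        Complex.exp (((r • v + t) ⬝ᵥ x.ofLp : ℝ) * Complex.I))
      (fun e : ℝ => Complex.exp ((r * s * e : ℝ) * Complex.I)),
    integral_prod_mul (fun y : ℝ => Complex.exp (((r + (t ⬝ᵥ a) / V) * y : ℝ) * Complex.I))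
      (fun x : EuclideanSpace ℝ (Fin d) => Complex.exp ((t ⬝ᵥ x.ofLp : ℝ) * Complex.I)),
    integral_exp_dotProduct_multivariateGaussian _ _ hp.posSemidef,
    integral_exp_dotProduct_multivariateGaussian _ _ (posDef_kalmanStep v s 0 hp).posSemidef,
    integral_exp_mul_gaussianReal _ _ hV.le, kalmanStep_snd_eq v hs 0 hp, ← ha, ← hVdef]
  have e3 := integral_exp_mul_gaussianReal (r * s) 0 zero_le_one
  rw [Real.toNNReal_one] at e3
  rw [e3, ← Complex.exp_add, ← Complex.exp_add, ← Complex.exp_add]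
  congr 1
  have hva : v ⬝ᵥ a = V - s ^ 2 := by rw [hVdef]; ring
  -- The two exponents agree by completing the square: r²V + 2r(t·a) + t·Σt = V(r + t·a/V)² + t·Σt −
  -- (t·a)²/V.
  have q1 : (r • v + t) ⬝ᵥ (p.2 *ᵥ (r • v + t)) =
      r ^ 2 * (V - s ^ 2) + 2 * r * (t ⬝ᵥ a) + t ⬝ᵥ (p.2 *ᵥ t) := by
    rw [Matrix.mulVec_add, Matrix.mulVec_smul, ← ha, add_dotProduct, dotProduct_add,
      dotProduct_add, smul_dotProduct, smul_dotProduct, dotProduct_smul, dotProduct_smul, hsymm, hva]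
    simp only [smul_eq_mul]
    ring
  have q2 : t ⬝ᵥ ((p.2 - (1 / V) • vecMulVec a a) *ᵥ t) =
      t ⬝ᵥ (p.2 *ᵥ t) - (t ⬝ᵥ a) ^ 2 / V := by
    rw [Matrix.sub_mulVec, Matrix.smul_mulVec, Matrix.vecMulVec_mulVec, dotProduct_sub,
      dotProduct_smul, op_smul_eq_smul, dotProduct_smul, dotProduct_comm a t]
    simp only [smul_eq_mul]
    ring
  rw [q1, q2, WithLp.ofLp_zero, dotProduct_zero, add_dotProduct, smul_dotProduct, smul_eq_mul,
    dotProduct_comm m v]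
  have hV' : (V : ℂ) ≠ 0 := by exact_mod_cast hV.ne'
  push_cast
  field_simp
  ring

theorem lintegral_kalmanStep (v : Fin d → ℝ) {s : ℝ} (hs : 0 < s)
    {p : EuclideanSpace ℝ (Fin d) × Matrix (Fin d) (Fin d) ℝ} (hp : p.2.PosDef)
    {F : ℝ × EuclideanSpace ℝ (Fin d) → ℝ≥0∞} (hF : Measurable F) :
    ∫⁻ x, ∫⁻ e, F (v ⬝ᵥ x.ofLp + s * e, x) ∂gaussianReal 0 1 ∂multivariateGaussian p.1 p.2 =
      ∫⁻ y, ∫⁻ x, F (y, x) ∂multivariateGaussian (kalmanStep v s y p).1 (kalmanStep v s y p).2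
        ∂gaussianReal (p.1.ofLp ⬝ᵥ v) (v ⬝ᵥ (p.2 *ᵥ v) + s ^ 2).toNNReal := by
  have hm1 : Measurable fun q : EuclideanSpace ℝ (Fin d) × ℝ => (v ⬝ᵥ q.1.ofLp + s * q.2, q.1) := by
    unfold dotProduct; fun_prop
  have hm2 : Measurable fun q : ℝ × EuclideanSpace ℝ (Fin d) =>
      (q.1, (kalmanStep v s q.1 p).1 + q.2) := by
    simp only [kalmanStep_fst_eq v hs _ hp]
    fun_prop
  have h := congrArg (fun μ => ∫⁻ q, F q ∂μ) (map_observation_eq v hs hp)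
  simp only at h
  rw [lintegral_map hF hm1, lintegral_map hF hm2, lintegral_prod (fun q => F (_, _)) (hF.comp hm1).aemeasurable,
    lintegral_prod (fun q => F (_, _)) (hF.comp hm2).aemeasurable] at h
  rw [h]
  refine lintegral_congr fun y => ?_
  rw [lintegral_multivariateGaussian (F := fun x => F (y, x)) _ _
    (hF.comp measurable_prodMk_left)]
  rfl

end BCT

/-! ### Measurable dependence of Gaussian laws and Kalman updates on their parameters -/

namespace BCT

/-- By Lévy's continuity theorem the measures depend weakly continuously on the parameter.
Indicators of closed sets are limits of bounded continuous functions, and closed sets form a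
generating π-system. -/
theorem measurable_of_continuous_charFun {T E : Type*} [TopologicalSpace T] [SequentialSpace T]
    [MeasurableSpace T] [OpensMeasurableSpace T] [NormedAddCommGroup E] [InnerProductSpace ℝ E]
    [FiniteDimensional ℝ E] [MeasurableSpace E] [BorelSpace E] {μ : T → Measure E}
    [∀ x, IsProbabilityMeasure (μ x)] (h : ∀ t, Continuous fun x => charFun (μ x) t) :
    Measurable μ := by
  have hc : ∀ f : BoundedContinuousFunction E NNReal, Continuous fun x => ∫⁻ y, f y ∂μ x := by
    intro f
    refine continuous_iff_seqContinuous.2 fun x x₀ hx => ?_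
    have := (ProbabilityMeasure.tendsto_of_tendsto_charFun
      (μ := fun n => (⟨μ (x n), inferInstance⟩ : ProbabilityMeasure E))
      (μ₀ := ⟨μ x₀, inferInstance⟩) fun t => ((h t).tendsto x₀).comp hx)
    exact ProbabilityMeasure.tendsto_iff_forall_lintegral_tendsto.1 this f
  refine Measurable.measure_of_isPiSystem_of_isProbabilityMeasure
    (BorelSpace.measurable_eq.trans (borel_eq_generateFrom_isClosed)) isPiSystem_isClosed ?_
  intro F hF
  exact measurable_of_tendsto_metrizable (fun n => (hc (hF.apprSeq n)).measurable)
    (tendsto_pi_nhds.2 fun x => HasOuterApproxClosed.tendsto_lintegral_apprSeq hF (μ x))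

variable {d : ℕ}

instance matrixBorelSpace : BorelSpace (Matrix (Fin d) (Fin d) ℝ) :=
  inferInstanceAs (BorelSpace (Fin d → Fin d → ℝ))

instance matrixSecondCountableTopology : SecondCountableTopology (Matrix (Fin d) (Fin d) ℝ) :=
  inferInstanceAs (SecondCountableTopology (Fin d → Fin d → ℝ))

theorem isClosed_posSemidef : IsClosed {S : Matrix (Fin d) (Fin d) ℝ | S.PosSemidef} := by
  simp only [Matrix.posSemidef_iff_dotProduct_mulVec, Matrix.IsHermitian, Set.ofPred_and,
    Set.ofPred_forall]
  refine (isClosed_eq (by fun_prop) (by fun_prop)).inter (isClosed_iInter fun x => ?_)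
  exact isClosed_le continuous_const (by fun_prop)

/-- On the closed set of positive semidefinite matrices the characteristic function is continuous in
mean and covariance, so no measurable matrix square root is needed. -/
theorem measurable_multivariateGaussian :
    Measurable fun p : EuclideanSpace ℝ (Fin d) × Matrix (Fin d) (Fin d) ℝ =>
      multivariateGaussian p.1 p.2 := by
  set s : Set (EuclideanSpace ℝ (Fin d) × Matrix (Fin d) (Fin d) ℝ) := {p | p.2.PosSemidef}
  have hs : MeasurableSet s := (isClosed_posSemidef.preimage continuous_snd).measurableSet
  refine measurable_of_restrict_of_restrict_compl hs ?_ ?_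
  · refine measurable_of_continuous_charFun (μ := fun x : s => multivariateGaussian x.1.1 x.1.2) fun t => ?_
    have : ∀ x : s, charFun (multivariateGaussian x.1.1 x.1.2) t =
        Complex.exp (inner ℝ t x.1.1 * Complex.I - (t.ofLp ⬝ᵥ x.1.2 *ᵥ t.ofLp : ℝ) / 2) :=
      fun x => charFun_multivariateGaussian x.2 t
    simp only [this]
    fun_prop
  -- For other matrices the default value of `multivariateGaussian` is the Dirac mass at the mean.
  · have : sᶜ.domRestrict (fun p => multivariateGaussian p.1 p.2) = fun x => Measure.dirac x.1.1 := by
      ext1 x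
      exact multivariateGaussian_of_not_posSemidef _ x.2
    rw [this]
    exact Measure.measurable_dirac.comp (measurable_fst.comp measurable_subtype_coe)

/-- Cramer's formula det⁻¹ · adj holds for singular matrices too, because the inverse of the real
number 0 is 0. -/
theorem measurable_matrix_inv :
    Measurable fun S : Matrix (Fin d) (Fin d) ℝ => S⁻¹ := by
  have h1 : Measurable fun S : Matrix (Fin d) (Fin d) ℝ => S.det :=
    (Continuous.matrix_det continuous_id).measurable
  have h2 : Measurable fun S : Matrix (Fin d) (Fin d) ℝ => S.adjugate :=
    (Continuous.matrix_adjugate continuous_id).measurable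
  simp only [Matrix.inv_def, Ring.inverse_eq_inv']
  exact h1.inv.smul h2

theorem measurable_kalmanStep {T : Type*} [MeasurableSpace T] {v : T → Fin d → ℝ} {s y : T → ℝ}
    {p : T → EuclideanSpace ℝ (Fin d) × Matrix (Fin d) (Fin d) ℝ} (hv : Measurable v)
    (hs : Measurable s) (hy : Measurable y) (hp : Measurable p) :
    Measurable fun x => kalmanStep (v x) (s x) (y x) (p x) := by
  have hvv : Measurable fun x => vecMulVec (v x) (v x) :=
    measurable_pi_lambda _ fun i => measurable_pi_lambda _ fun j =>
      ((measurable_pi_apply i).comp hv).mul ((measurable_pi_apply j).comp hv)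
  have hS : Measurable fun x => ((p x).2⁻¹ + (1 / s x ^ 2) • vecMulVec (v x) (v x))⁻¹ :=
    measurable_matrix_inv.comp (((measurable_matrix_inv.comp hp.snd)).add
      (((hs.pow_const 2).const_div 1).smul hvv))
  have hSv : Measurable fun x =>
      ((p x).2⁻¹ + (1 / s x ^ 2) • vecMulVec (v x) (v x))⁻¹ *ᵥ v x :=
    (Continuous.matrix_mulVec continuous_fst continuous_snd).measurable.comp (hS.prodMk hv)
  have hdot : Measurable fun x => v x ⬝ᵥ (p x).1.ofLp := by
    have := hp.fst
    unfold dotProduct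
    fun_prop
  refine Measurable.prodMk (hp.fst.add ((WithLp.measurable_toLp 2 _).comp ?_)) hS
  exact (((hs.pow_const 2).const_div 1).mul (hy.sub hdot)).smul hSv

theorem measurable_map_of_uncurry {T S F : Type*} [MeasurableSpace T] [MeasurableSpace S]
    [MeasurableSpace F] {μ : T → Measure S} (hμ : Measurable μ) [∀ x, IsProbabilityMeasure (μ x)]
    {g : T × S → F} (hg : Measurable g) : Measurable fun x => (μ x).map fun y => g (x, y) := by
  let k : Kernel T S := ⟨μ, hμ⟩
  have : IsMarkovKernel k := ⟨fun s => inferInstanceAs (IsProbabilityMeasure (μ s))⟩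
  refine Measure.measurable_of_measurable_coe _ fun A hA => ?_
  have h := Kernel.measurable_kernel_prodMk_left (κ := k) (hg hA)
  convert! h using 2 with x
  rw [Measure.map_apply (f := fun y => g (x, y)) (hg.comp measurable_prodMk_left) hA]
  rfl

theorem measurable_prod {T S F : Type*} [MeasurableSpace T] [MeasurableSpace S]
    [MeasurableSpace F] {μ : T → Measure S} (hμ : Measurable μ) [∀ x, IsProbabilityMeasure (μ x)]
    {ν : T → Measure F} (hν : Measurable ν) [∀ x, IsProbabilityMeasure (ν x)] :
    Measurable fun x => (μ x).prod (ν x) := by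
  let k : Kernel T S := ⟨μ, hμ⟩
  let l : Kernel T F := ⟨ν, hν⟩
  have : IsMarkovKernel k := ⟨fun s => inferInstanceAs (IsProbabilityMeasure (μ s))⟩
  have : IsMarkovKernel l := ⟨fun s => inferInstanceAs (IsProbabilityMeasure (ν s))⟩
  have h := (k ×ₖ l).measurable
  convert! h using 2 with x
  rw [Kernel.prod_apply]
  rfl

end BCT

/-! ### Regrouping of independent variables, and Bayes' rule for products -/

namespace BCT

/-- On boxes the joint law factors in two stages. This is the regrouping rule that assembles the
separate independence assumptions on the noise. -/
theorem indepFun_prodMk_left_of_indepFun {Ω A B C : Type*} [MeasurableSpace Ω] [MeasurableSpace A]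
    [MeasurableSpace B] [MeasurableSpace C] {P : Measure Ω} [IsProbabilityMeasure P] {X : Ω → A}
    {Y : Ω → B} {Z : Ω → C} (hX : Measurable X) (hY : Measurable Y) (hZ : Measurable Z)
    (h : IndepFun X (fun ω => (Y ω, Z ω)) P) (h' : IndepFun Y Z P) :
    IndepFun (fun ω => (X ω, Y ω)) Z P := by
  have hXY : IndepFun X Y P := h.comp measurable_id measurable_fst
  rw [indepFun_iff_map_prod_eq_prod_map_map (hX.prodMk hY).aemeasurable hZ.aemeasurable]
  have := Measure.isProbabilityMeasure_map (μ := P) hX.aemeasurable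
  have := Measure.isProbabilityMeasure_map (μ := P) hY.aemeasurable
  have := Measure.isProbabilityMeasure_map (μ := P) hZ.aemeasurable
  have := Measure.isProbabilityMeasure_map (μ := P) (hX.prodMk hY).aemeasurable
  have := Measure.isProbabilityMeasure_map (μ := P) ((hX.prodMk hY).prodMk hZ).aemeasurable
  refine Measure.ext_prod₃' fun {s t v} hs ht hv => ?_
  rw [Measure.prod_prod, (indepFun_iff_map_prod_eq_prod_map_map hX.aemeasurable
    hY.aemeasurable).1 hXY, Measure.prod_prod, Measure.map_apply hX hs, Measure.map_apply hY ht,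
    Measure.map_apply hZ hv, Measure.map_apply ((hX.prodMk hY).prodMk hZ) ((hs.prod ht).prod hv)]
  have e : (fun ω => ((X ω, Y ω), Z ω)) ⁻¹' ((s ×ˢ t) ×ˢ v) =
      X ⁻¹' s ∩ (fun ω => (Y ω, Z ω)) ⁻¹' (t ×ˢ v) := by
    ext ω; simp [and_assoc]
  have e' : (fun ω => (Y ω, Z ω)) ⁻¹' (t ×ˢ v) = Y ⁻¹' t ∩ Z ⁻¹' v := rfl
  rw [e, h.measure_inter_preimage_eq_mul _ _ hs (ht.prod hv), e',
    h'.measure_inter_preimage_eq_mul _ _ ht hv, mul_assoc]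

/-- Tonelli brings the second block innermost, where `h₂` applies with the first block frozen. Then
`h₁` applies to what remains, and a second exchange restores the product order. -/
theorem lintegral_prod_bayes {A B E₁ E₂ X Y : Type*} [MeasurableSpace A] [MeasurableSpace B]
    [MeasurableSpace E₁] [MeasurableSpace E₂] [MeasurableSpace X] [MeasurableSpace Y]
    {μ₁ : Measure A} {μ₂ : Measure B} {ν₁ : Measure E₁} {ν₂ : Measure E₂} {ρ₁ : Measure X}
    {ρ₂ : Measure Y} [IsProbabilityMeasure μ₁] [IsProbabilityMeasure μ₂] [IsProbabilityMeasure ν₁]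
    [IsProbabilityMeasure ν₂] [IsProbabilityMeasure ρ₁] [IsProbabilityMeasure ρ₂]
    {κ₁ : X → Measure A} (hκ₁ : Measurable κ₁) [∀ x, IsProbabilityMeasure (κ₁ x)]
    {κ₂ : Y → Measure B} (hκ₂ : Measurable κ₂) [∀ y, IsProbabilityMeasure (κ₂ y)]
    {g₁ : A × E₁ → X} (hg₁ : Measurable g₁) {g₂ : B × E₂ → Y} (hg₂ : Measurable g₂)
    (h₁ : ∀ F : X × A → ℝ≥0∞, Measurable F →
      ∫⁻ a, ∫⁻ e, F (g₁ (a, e), a) ∂ν₁ ∂μ₁ = ∫⁻ x, ∫⁻ a, F (x, a) ∂κ₁ x ∂ρ₁)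
    (h₂ : ∀ F : Y × B → ℝ≥0∞, Measurable F →
      ∫⁻ b, ∫⁻ e, F (g₂ (b, e), b) ∂ν₂ ∂μ₂ = ∫⁻ y, ∫⁻ b, F (y, b) ∂κ₂ y ∂ρ₂)
    {F : (X × Y) × (A × B) → ℝ≥0∞} (hF : Measurable F) :
    ∫⁻ q, ∫⁻ e, F ((g₁ (q.1, e.1), g₂ (q.2, e.2)), q) ∂ν₁.prod ν₂ ∂μ₁.prod μ₂ =
      ∫⁻ w, ∫⁻ q, F (w, q) ∂(κ₁ w.1).prod (κ₂ w.2) ∂ρ₁.prod ρ₂ := by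
  let k₁ : Kernel X A := ⟨κ₁, hκ₁⟩
  let k₂ : Kernel Y B := ⟨κ₂, hκ₂⟩
  have : IsMarkovKernel k₁ := ⟨fun s => inferInstanceAs (IsProbabilityMeasure (κ₁ s))⟩
  have : IsMarkovKernel k₂ := ⟨fun s => inferInstanceAs (IsProbabilityMeasure (κ₂ s))⟩
  have hG : Measurable fun p : (X × A) × Y => ∫⁻ b, F ((p.1.1, p.2), (p.1.2, b)) ∂κ₂ p.2 := by
    refine Measurable.lintegral_kernel_prod_right'
      (κ := k₂.comap (fun p : (X × A) × Y => p.2) measurable_snd)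
      (f := fun q : ((X × A) × Y) × B => F ((q.1.1.1, q.1.2), (q.1.1.2, q.2))) ?_
    fun_prop
  have hL : Measurable fun q : ((A × B) × (E₁ × E₂)) =>
      F ((g₁ (q.1.1, q.2.1), g₂ (q.1.2, q.2.2)), q.1) := by fun_prop
  calc _ = ∫⁻ a, ∫⁻ b, ∫⁻ e₁, ∫⁻ e₂, F ((g₁ (a, e₁), g₂ (b, e₂)), (a, b)) ∂ν₂ ∂ν₁ ∂μ₂ ∂μ₁ := by
        rw [lintegral_prod _ hL.lintegral_prod_right'.aemeasurable]
        refine lintegral_congr fun a => lintegral_congr fun b => ?_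
        exact lintegral_prod _ (hL.comp measurable_prodMk_left).aemeasurable
    _ = ∫⁻ a, ∫⁻ e₁, ∫⁻ b, ∫⁻ e₂, F ((g₁ (a, e₁), g₂ (b, e₂)), (a, b)) ∂ν₂ ∂μ₂ ∂ν₁ ∂μ₁ := by
        refine lintegral_congr fun a => lintegral_lintegral_swap ?_
        refine Measurable.aemeasurable ?_
        refine Measurable.lintegral_prod_right'
          (f := fun q : (B × E₁) × E₂ => F ((g₁ (a, q.1.2), g₂ (q.1.1, q.2)), (a, q.1.1))) ?_
        fun_prop
    _ = ∫⁻ a, ∫⁻ e₁, ∫⁻ y, ∫⁻ b, F ((g₁ (a, e₁), y), (a, b)) ∂κ₂ y ∂ρ₂ ∂ν₁ ∂μ₁ := by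
        refine lintegral_congr fun a => lintegral_congr fun e₁ => ?_
        exact h₂ (fun p => F ((g₁ (a, e₁), p.1), (a, p.2))) (by fun_prop)
    _ = ∫⁻ x, ∫⁻ a, ∫⁻ y, ∫⁻ b, F ((x, y), (a, b)) ∂κ₂ y ∂ρ₂ ∂κ₁ x ∂ρ₁ :=
        h₁ (fun p => ∫⁻ y, ∫⁻ b, F ((p.1, y), (p.2, b)) ∂κ₂ y ∂ρ₂) hG.lintegral_prod_right'
    _ = ∫⁻ x, ∫⁻ y, ∫⁻ a, ∫⁻ b, F ((x, y), (a, b)) ∂κ₂ y ∂κ₁ x ∂ρ₂ ∂ρ₁ := by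
        refine lintegral_congr fun x => lintegral_lintegral_swap ?_
        exact (hG.comp (g := fun p => _) (f := fun q : A × Y => ((x, q.1), q.2))
          (by fun_prop)).aemeasurable
    _ = _ := by
        rw [lintegral_prod]
        · refine lintegral_congr fun x => lintegral_congr fun y => ?_
          exact (lintegral_prod _ (hF.comp measurable_prodMk_left).aemeasurable).symm
        · exact (hF.lintegral_kernel_prod_right'
            (κ := (k₁.comap Prod.fst measurable_fst) ×ₖ
              (k₂.comap (Prod.snd : X × Y → Y) measurable_snd))).aemeasurable.congr
            (Filter.Eventually.of_forall fun w => by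
              simp only [Kernel.prod_apply]
              rfl)

/-! ### Measurability in the model, observable history and filter -/

namespace Model

variable {Ω U : Type*} [MeasurableSpace U] {J K : ℕ} (M : Model U J K)

theorem measurable_phiVec : Measurable M.phiVec := measurable_pi_lambda _ M.measurable_phi

theorem measurable_psiVec : Measurable M.psiVec := measurable_pi_lambda _ M.measurable_psi

theorem sigmaH_pos (u : U) : 0 < M.sigmaH u := by
  obtain ⟨c, hc, h⟩ := M.sigmaH_lower
  exact hc.trans_le (h u)

theorem sigmaT_pos (u : U) : 0 < M.sigmaT u := by
  obtain ⟨c, hc, h⟩ := M.sigmaT_lower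
  exact hc.trans_le (h u)

theorem measurable_trueScore {T : Type*} {mT : MeasurableSpace T} {a : T → EuclideanSpace ℝ (Fin J)}
    (ha : Measurable a) {u : T → U} (hu : Measurable u) :
    Measurable fun x => M.trueScore (a x) (u x) := by
  have := M.measurable_phi
  unfold trueScore
  fun_prop

theorem measurable_trueCost {T : Type*} {mT : MeasurableSpace T} {b : T → EuclideanSpace ℝ (Fin K)}
    (hb : Measurable b) {u : T → U} (hu : Measurable u) :
    Measurable fun x => M.trueCost (b x) (u x) := by
  have := M.measurable_psi
  unfold trueCost
  fun_prop

theorem measurable_filterStep {T : Type*} {mT : MeasurableSpace T} {x : T → FilterState J K} {u : T → U}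
    {h t : T → ℝ} (hx : Measurable x) (hu : Measurable u) (hh : Measurable h) (ht : Measurable t) :
    Measurable fun z => M.filterStep (x z) (u z) (h z) (t z) :=
  (measurable_kalmanStep (M.measurable_phiVec.comp hu) (M.measurable_sigmaH.comp hu) hh hx.fst).prodMk
    (measurable_kalmanStep (M.measurable_psiVec.comp hu) (M.measurable_sigmaT.comp hu) ht hx.snd)

/-- The Gaussian law of the coefficient vectors described by the filter parameters. -/
noncomputable def posterior (x : FilterState J K) :
    Measure (EuclideanSpace ℝ (Fin J) × EuclideanSpace ℝ (Fin K)) :=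
  (multivariateGaussian x.1.1 x.1.2).prod (multivariateGaussian x.2.1 x.2.2)

instance (x : FilterState J K) : IsProbabilityMeasure (posterior x) := by
  unfold posterior; infer_instance

theorem measurable_posterior : Measurable (posterior (J := J) (K := K)) :=
  measurable_prod (μ := fun x : FilterState J K => multivariateGaussian x.1.1 x.1.2)
    (ν := fun x : FilterState J K => multivariateGaussian x.2.1 x.2.2)
    (measurable_multivariateGaussian.comp measurable_fst)
    (measurable_multivariateGaussian.comp measurable_snd)

/-- The law of the next observations in state `x` under the control `u`. -/
noncomputable def obsLaw (x : FilterState J K) (u : U) : Measure (ℝ × ℝ) :=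
  (gaussianReal (x.1.1.ofLp ⬝ᵥ M.phiVec u)
      (M.phiVec u ⬝ᵥ (x.1.2 *ᵥ M.phiVec u) + M.sigmaH u ^ 2).toNNReal).prod
    (gaussianReal (x.2.1.ofLp ⬝ᵥ M.psiVec u)
      (M.psiVec u ⬝ᵥ (x.2.2 *ᵥ M.psiVec u) + M.sigmaT u ^ 2).toNNReal)

instance (x : FilterState J K) (u : U) : IsProbabilityMeasure (M.obsLaw x u) := by
  unfold obsLaw; infer_instance

theorem measurable_obsLaw : Measurable fun p : FilterState J K × U => M.obsLaw p.1 p.2 := by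
  have h1 := M.measurable_phiVec
  have h2 := M.measurable_psiVec
  have h3 := M.measurable_sigmaH
  have h4 := M.measurable_sigmaT
  have dot : ∀ d : ℕ, Measurable fun q : (Fin d → ℝ) × (Fin d → ℝ) => q.1 ⬝ᵥ q.2 := fun d => by
    unfold dotProduct; fun_prop
  have mv : ∀ d : ℕ, Measurable fun q : Matrix (Fin d) (Fin d) ℝ × (Fin d → ℝ) => q.1 *ᵥ q.2 :=
    fun d => (Continuous.matrix_mulVec continuous_fst continuous_snd).measurable
  have hv1 : Measurable fun p : FilterState J K × U => p.1.1.2 *ᵥ M.phiVec p.2 :=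
    (mv J).comp (f := fun p : FilterState J K × U => (p.1.1.2, M.phiVec p.2)) (by fun_prop)
  have hv2 : Measurable fun p : FilterState J K × U => p.1.2.2 *ᵥ M.psiVec p.2 :=
    (mv K).comp (f := fun p : FilterState J K × U => (p.1.2.2, M.psiVec p.2)) (by fun_prop)
  refine measurable_prod
    (μ := fun p : FilterState J K × U => gaussianReal (p.1.1.1.ofLp ⬝ᵥ M.phiVec p.2)
      (M.phiVec p.2 ⬝ᵥ (p.1.1.2 *ᵥ M.phiVec p.2) + M.sigmaH p.2 ^ 2).toNNReal)
    (ν := fun p : FilterState J K × U => gaussianReal (p.1.2.1.ofLp ⬝ᵥ M.psiVec p.2)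
      (M.psiVec p.2 ⬝ᵥ (p.1.2.2 *ᵥ M.psiVec p.2) + M.sigmaT p.2 ^ 2).toNNReal)
    (measurable_gaussianReal.comp (Measurable.prodMk ?_ ?_))
    (measurable_gaussianReal.comp (Measurable.prodMk ?_ ?_))
  · exact (dot J).comp (f := fun p : FilterState J K × U => (p.1.1.1.ofLp, M.phiVec p.2))
      (by fun_prop)
  · exact (((dot J).comp (f := fun p : FilterState J K × U =>
      (M.phiVec p.2, p.1.1.2 *ᵥ M.phiVec p.2)) (by fun_prop)).add (by fun_prop)).real_toNNReal
  · exact (dot K).comp (f := fun p : FilterState J K × U => (p.1.2.1.ofLp, M.psiVec p.2))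
      (by fun_prop)
  · exact (((dot K).comp (f := fun p : FilterState J K × U =>
      (M.psiVec p.2, p.1.2.2 *ᵥ M.psiVec p.2)) (by fun_prop)).add (by fun_prop)).real_toNNReal

theorem transition_eq_map_obsLaw (x : FilterState J K) (u : U) :
    M.transition x u = (M.obsLaw x u).map fun y => (M.filterStep x u y.1 y.2, y.2) := rfl

theorem measurable_transition :
    Measurable fun p : FilterState J K × U => M.transition p.1 p.2 :=
  measurable_map_of_uncurry M.measurable_obsLaw
    (g := fun q => (M.filterStep q.1.1 q.1.2 q.2.1 q.2.2, q.2.2))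
    ((M.measurable_filterStep measurable_fst.fst measurable_fst.snd measurable_snd.fst
      measurable_snd.snd).prodMk measurable_snd.snd)

theorem isProbabilityMeasure_transition (x : FilterState J K) (u : U) :
    IsProbabilityMeasure (M.transition x u) :=
  Measure.isProbabilityMeasure_map (((M.measurable_filterStep measurable_const measurable_const
    measurable_fst measurable_snd).prodMk measurable_snd).aemeasurable)

/-- This is the hypothesis `key` of `DisintegratesOver.bayes` in state `x`: each block is a single
Kalman step, and the blocks are independent under prior, noise and predictive law. -/
theorem lintegral_posterior_filterStep {x : FilterState J K} (hA : x.1.2.PosDef)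
    (hB : x.2.2.PosDef) (u : U)
    {F : (ℝ × ℝ) × (EuclideanSpace ℝ (Fin J) × EuclideanSpace ℝ (Fin K)) → ℝ≥0∞}
    (hF : Measurable F) :
    ∫⁻ q, ∫⁻ e, F ((M.trueScore q.1 u + M.sigmaH u * e.1, M.trueCost q.2 u + M.sigmaT u * e.2), q)
        ∂(gaussianReal 0 1).prod (gaussianReal 0 1) ∂posterior x =
      ∫⁻ w, ∫⁻ q, F (w, q) ∂posterior (M.filterStep x u w.1 w.2) ∂M.obsLaw x u := by
  have e1 : ∀ a, M.trueScore a u = M.phiVec u ⬝ᵥ a.ofLp := fun a => dotProduct_comm _ _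
  have e2 : ∀ b, M.trueCost b u = M.psiVec u ⬝ᵥ b.ofLp := fun b => dotProduct_comm _ _
  refine lintegral_prod_bayes
    (g₁ := fun p => M.trueScore p.1 u + M.sigmaH u * p.2)
    (g₂ := fun p => M.trueCost p.1 u + M.sigmaT u * p.2)
    (κ₁ := fun y => multivariateGaussian (kalmanStep (M.phiVec u) (M.sigmaH u) y x.1).1
      (kalmanStep (M.phiVec u) (M.sigmaH u) y x.1).2)
    (κ₂ := fun y => multivariateGaussian (kalmanStep (M.psiVec u) (M.sigmaT u) y x.2).1
      (kalmanStep (M.psiVec u) (M.sigmaT u) y x.2).2)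
    (measurable_multivariateGaussian.comp (measurable_kalmanStep measurable_const measurable_const
      measurable_id measurable_const))
    (measurable_multivariateGaussian.comp (measurable_kalmanStep measurable_const measurable_const
      measurable_id measurable_const))
    ((M.measurable_trueScore measurable_fst measurable_const).add (by fun_prop))
    ((M.measurable_trueCost measurable_fst measurable_const).add (by fun_prop)) ?_ ?_ hF
  · intro G hG
    simp only [e1]
    exact lintegral_kalmanStep (M.phiVec u) (M.sigmaH_pos u) hA hG
  · intro G hG
    simp only [e2]
    exact lintegral_kalmanStep (M.psiVec u) (M.sigmaT_pos u) hB hG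

variable {M} {N : Noise Ω J K} {u : ℕ → Ω → U}

theorem history_succ (n : ℕ) :
    M.history N u (n + 1) = M.history N u n ⊔
      MeasurableSpace.comap (fun ω => (M.obsScore N u n ω, M.obsCost N u n ω)) inferInstance := by
  rw [Prod.instMeasurableSpace, MeasurableSpace.comap_prodMk]
  refine le_antisymm (iSup_le fun i => ?_) (sup_le (iSup_le fun i => ?_) ?_)
  · induction i using Fin.lastCases with
    | last => exact le_sup_right
    | cast i =>
      exact (le_iSup (fun i : Fin n => MeasurableSpace.comap (M.obsScore N u i) inferInstance ⊔
        MeasurableSpace.comap (M.obsCost N u i) inferInstance) i).trans le_sup_left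
  · exact le_iSup (fun i : Fin (n + 1) => MeasurableSpace.comap (M.obsScore N u i) inferInstance ⊔
        MeasurableSpace.comap (M.obsCost N u i) inferInstance) i.castSucc
  · exact le_iSup (fun i : Fin (n + 1) => MeasurableSpace.comap (M.obsScore N u i) inferInstance ⊔
        MeasurableSpace.comap (M.obsCost N u i) inferInstance) (Fin.last n)

theorem history_zero : M.history N u 0 = ⊥ := by
  simp [history]

theorem measurable_obs [MeasurableSpace Ω] {n : ℕ} (hu : Measurable (u n))
    (hα : Measurable N.alpha) (hβ : Measurable N.beta) (hε : Measurable (N.eps n))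
    (hη : Measurable (N.eta n)) :
    Measurable fun ω => (M.obsScore N u n ω, M.obsCost N u n ω) :=
  ((M.measurable_trueScore hα hu).add ((M.measurable_sigmaH.comp hu).mul hε)).prodMk
    ((M.measurable_trueCost hβ hu).add ((M.measurable_sigmaT.comp hu).mul hη))

/-- Controls feed back into observations, so the inclusion is inductive: once the history up to n
lies in `m`, so does u_n, and with it the next observation. The general `m` covers both the ambient
σ-algebra and the one generated by the coefficients and the first n errors. -/
theorem IsControl.history_le (hu : M.IsControl N u) {m : MeasurableSpace Ω}
    (hα : Measurable[m] N.alpha) (hβ : Measurable[m] N.beta) (n : ℕ)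
    (hε : ∀ i < n, Measurable[m] (N.eps i)) (hη : ∀ i < n, Measurable[m] (N.eta i)) :
    M.history N u n ≤ m := by
  induction n with
  | zero => rw [history_zero]; exact bot_le
  | succ n ih =>
    have ih := ih (fun i hi => hε i (by omega)) (fun i hi => hη i (by omega))
    rw [history_succ]
    refine sup_le ih (Measurable.comap_le ?_)
    exact measurable_obs ((hu n).mono ih le_rfl) hα hβ (hε n (by omega)) (hη n (by omega))

theorem IsControl.measurable_filter (hu : M.IsControl N u) (n : ℕ) :
    Measurable[M.history N u n] (M.filter N u n) := by
  induction n with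
  | zero =>
    have : M.filter N u 0 = fun _ => ((M.muA, M.SigmaA), (M.muB, M.SigmaB)) := rfl
    rw [this]
    exact measurable_const
  | succ n ih =>
    have hle : M.history N u n ≤ M.history N u (n + 1) := by rw [history_succ]; exact le_sup_left
    have hobs : Measurable[M.history N u (n + 1)]
        fun ω => (M.obsScore N u n ω, M.obsCost N u n ω) := by
      rw [history_succ]
      exact (comap_measurable _).mono le_sup_right le_rfl
    exact M.measurable_filterStep (ih.mono hle le_rfl) ((hu n).mono hle le_rfl) hobs.fst hobs.snd

theorem IsAdmissible.measurable_control_pred {τ : Ω → ℕ∞} (hu : M.IsAdmissible N u τ) (n : ℕ) :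
    Measurable[M.history N u n] (u (n - 1)) := by
  -- Truncated subtraction makes `n - 1 = 0` at n = 0, where u_0 is still measurable for the trivial
  -- history.
  cases n with
  | zero => exact hu.1 0
  | succ n => exact (hu.1 n).mono (by rw [history_succ]; exact le_sup_left) le_rfl

theorem IsAdmissible.measurable_score_pred {τ : Ω → ℕ∞} (hu : M.IsAdmissible N u τ) (n : ℕ) :
    Measurable[(M.history N u n).prod inferInstance]
      fun p : Ω × (EuclideanSpace ℝ (Fin J) × EuclideanSpace ℝ (Fin K)) =>
        M.trueScore p.2.1 (u (n - 1) p.1) := by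
  have hs : Measurable[(M.history N u n).prod inferInstance]
      fun p : Ω × (EuclideanSpace ℝ (Fin J) × EuclideanSpace ℝ (Fin K)) => p.2 := measurable_snd
  exact M.measurable_trueScore hs.fst ((hu.measurable_control_pred n).comp measurable_fst)

theorem posDef_filter (n : ℕ) (ω : Ω) :
    (M.filter N u n ω).1.2.PosDef ∧ (M.filter N u n ω).2.2.PosDef := by
  induction n with
  | zero => exact ⟨M.posDef_SigmaA, M.posDef_SigmaB⟩
  | succ n ih => exact ⟨posDef_kalmanStep _ _ _ ih.1, posDef_kalmanStep _ _ _ ih.2⟩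

end Model

end BCT

/-! ### The filter as conditional law, by induction on time -/

namespace BCT

variable {Ω U : Type*} [mΩ : MeasurableSpace Ω] [MeasurableSpace U] {J K : ℕ} {M : Model U J K}
  {N : Noise Ω J K} {P : Measure Ω} {u : ℕ → Ω → U}

namespace Noise.IsDriving

theorem history_le (hN : N.IsDriving M P) (hu : M.IsControl N u) (n : ℕ) :
    M.history N u n ≤ mΩ :=
  hu.history_le hN.measurable_alpha hN.measurable_beta n (fun i _ => hN.measurable_eps i)
    fun i _ => hN.measurable_eta i

theorem measurable_obs (hN : N.IsDriving M P) (hu : M.IsControl N u) (n : ℕ) :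
    Measurable fun ω => (M.obsScore N u n ω, M.obsCost N u n ω) :=
  Model.measurable_obs ((hu n).mono (hN.history_le hu n) le_rfl) hN.measurable_alpha
    hN.measurable_beta (hN.measurable_eps n) (hN.measurable_eta n)

variable [IsProbabilityMeasure P]

theorem map_errors_eq (hN : N.IsDriving M P) (n : ℕ) :
    P.map (fun ω => (N.eps n ω, N.eta n ω)) = (gaussianReal 0 1).prod (gaussianReal 0 1) := by
  have h : IndepFun (N.eps n) (N.eta n) P :=
    hN.indep_eps_eta.comp (measurable_pi_apply n) (measurable_pi_apply n)
  rw [(indepFun_iff_map_prod_eq_prod_map_map (hN.measurable_eps n).aemeasurable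
    (hN.measurable_eta n).aemeasurable).1 h, hN.law_eps, hN.law_eta]

/-- The new errors carry index n and the past ones the indices below n. The past η errors are split
off first, then the past ε errors, and finally the coefficients. -/
theorem indepFun_past_errors (hN : N.IsDriving M P) (n : ℕ) :
    IndepFun (fun ω => ((N.alpha ω, N.beta ω),
        ((fun i : Finset.range n => N.eps i ω), (fun i : Finset.range n => N.eta i ω))))
      (fun ω => (N.eps n ω, N.eta n ω)) P := by
  have mε := hN.measurable_eps
  have mη := hN.measurable_eta
  have mα := hN.measurable_alpha
  have mβ := hN.measurable_beta
  have mεp : Measurable fun ω => (fun i : Finset.range n => N.eps i ω) :=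
    measurable_pi_lambda _ fun i => mε i
  have mηp : Measurable fun ω => (fun i : Finset.range n => N.eta i ω) :=
    measurable_pi_lambda _ fun i => mη i
  have hdisj : Disjoint (Finset.range n) {n} := by simp
  have hε : IndepFun (fun ω => (fun i : Finset.range n => N.eps i ω)) (N.eps n) P :=
    (hN.indep_eps.indepFun_finset _ _ hdisj mε).comp measurable_id
      (measurable_pi_apply (⟨n, by simp⟩ : ({n} : Finset ℕ)))
  have hη : IndepFun (fun ω => (fun i : Finset.range n => N.eta i ω)) (N.eta n) P :=
    (hN.indep_eta.indepFun_finset _ _ hdisj mη).comp measurable_id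
      (measurable_pi_apply (⟨n, by simp⟩ : ({n} : Finset ℕ)))
  have hεη : IndepFun
      (fun ω => ((fun i : Finset.range n => N.eps i ω), N.eps n ω))
      (fun ω => ((fun i : Finset.range n => N.eta i ω), N.eta n ω)) P :=
    hN.indep_eps_eta.comp
      (φ := fun f : ℕ → ℝ => ((fun i : Finset.range n => f i), f n))
      (ψ := fun f : ℕ → ℝ => ((fun i : Finset.range n => f i), f n)) (by fun_prop) (by fun_prop)
  have h1 : IndepFun (fun ω => (N.eps n ω, N.eta n ω))
      (fun ω => (fun i : Finset.range n => N.eta i ω)) P :=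
    indepFun_prodMk_left_of_indepFun (mε n) (mη n) mηp
      (hεη.comp measurable_snd (measurable_snd.prodMk measurable_fst)) hη.symm
  have h2 : IndepFun
      (fun ω => (((fun i : Finset.range n => N.eta i ω), N.eta n ω), N.eps n ω))
      (fun ω => (fun i : Finset.range n => N.eps i ω)) P :=
    indepFun_prodMk_left_of_indepFun (mηp.prodMk (mη n)) (mε n) mεp
      (hεη.symm.comp measurable_id (measurable_snd.prodMk measurable_fst)) hε.symm
  have h3 : IndepFun
      (fun ω => ((fun i : Finset.range n => N.eps i ω), (fun i : Finset.range n => N.eta i ω)))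
      (fun ω => (N.eps n ω, N.eta n ω)) P :=
    indepFun_prodMk_left_of_indepFun mεp mηp ((mε n).prodMk (mη n))
      (h2.symm.comp (ψ := fun q : ((Finset.range n → ℝ) × ℝ) × ℝ => (q.1.1, (q.2, q.1.2))) measurable_id (by fun_prop)) h1.symm
  refine indepFun_prodMk_left_of_indepFun (mα.prodMk mβ) (mεp.prodMk mηp)
    ((mε n).prodMk (mη n)) ?_ h3
  exact hN.indep_coeff_errors.comp
    (ψ := fun f : (ℕ → ℝ) × (ℕ → ℝ) =>
      (((fun i : Finset.range n => f.1 i), (fun i : Finset.range n => f.2 i)), (f.1 n, f.2 n)))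
    measurable_id (by fun_prop)

/-- History and coefficients are jointly determined by the coefficients and the errors of index
below n, so independence makes the conditional law of the new errors constant. -/
theorem disintegrates_errors (hN : N.IsDriving M P) (hu : M.IsControl N u) (n : ℕ) :
    DisintegratesOver P
      (M.history N u n ⊔ MeasurableSpace.comap (fun ω => (N.alpha ω, N.beta ω)) inferInstance)
      (fun ω => (N.eps n ω, N.eta n ω))
      fun _ => (gaussianReal 0 1).prod (gaussianReal 0 1) := by
  have hind : ∀ D, MeasurableSet D → ∀ B, MeasurableSet B → _ := fun D hD B hB =>
    (hN.indepFun_past_errors n).measure_inter_preimage_eq_mul D B hD hB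
  have hlaw : ∀ B, MeasurableSet B → ((gaussianReal 0 1).prod (gaussianReal 0 1)) B =
      P ((fun ω => (N.eps n ω, N.eta n ω)) ⁻¹' B) := fun B hB => by
    rw [← hN.map_errors_eq n]
    exact Measure.map_apply (μ := P) ((hN.measurable_eps n).prodMk (hN.measurable_eta n)) hB
  set past := fun ω => ((N.alpha ω, N.beta ω),
        ((fun i : Finset.range n => N.eps i ω), (fun i : Finset.range n => N.eta i ω))) with hpast
  set G : MeasurableSpace Ω := MeasurableSpace.comap past inferInstance with hG
  have hp : Measurable[G] past := comap_measurable past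
  have hle : M.history N u n ⊔
      MeasurableSpace.comap (fun ω => (N.alpha ω, N.beta ω)) inferInstance ≤ G := by
    refine sup_le (hu.history_le hp.fst.fst hp.fst.snd n (fun i hi => ?_) fun i hi => ?_)
      hp.fst.comap_le
    · exact (measurable_pi_apply (⟨i, Finset.mem_range.2 hi⟩ : Finset.range n)).comp hp.snd.fst
    · exact (measurable_pi_apply (⟨i, Finset.mem_range.2 hi⟩ : Finset.range n)).comp hp.snd.snd
  intro A hA B hB
  obtain ⟨D, hD, rfl⟩ := hle _ hA
  rw [hind D hD B hB, setLIntegral_const, hlaw B hB, mul_comm]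

/-- Bayes' rule with the coefficients as unknown and the two new errors as noise. The control enters
`g` only through ω, where it is measurable for the history. -/
theorem disintegrates_step (hN : N.IsDriving M P) (hu : M.IsControl N u) (n : ℕ)
    (h : DisintegratesOver P (M.history N u n) (fun ω => (N.alpha ω, N.beta ω))
      fun ω => Model.posterior (M.filter N u n ω)) :
    DisintegratesOver P (M.history N u n) (fun ω => (M.obsScore N u n ω, M.obsCost N u n ω))
      (fun ω => M.obsLaw (M.filter N u n ω) (u n ω)) ∧
    DisintegratesOver P (M.history N u (n + 1)) (fun ω => (N.alpha ω, N.beta ω))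
      fun ω => Model.posterior (M.filter N u (n + 1) ω) := by
  have hx := hu.measurable_filter n
  have hun := hu n
  rw [Model.history_succ]
  refine DisintegratesOver.bayes (hN.history_le hu n)
    (hN.measurable_alpha.prodMk hN.measurable_beta)
    ((hN.measurable_eps n).prodMk (hN.measurable_eta n)) (Model.measurable_posterior.comp hx) h
    (κ := fun ω => Model.posterior (M.filter N u n ω)) (hN.disintegrates_errors hu n)
    (g := fun p => (M.trueScore p.2.1.1 (u n p.1) + M.sigmaH (u n p.1) * p.2.2.1,
      M.trueCost p.2.1.2 (u n p.1) + M.sigmaT (u n p.1) * p.2.2.2)) ?_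
    (ρ := fun ω => M.obsLaw (M.filter N u n ω) (u n ω)) (M.measurable_obsLaw.comp (hx.prodMk hun))
    (κ' := fun p => Model.posterior
      (M.filterStep (M.filter N u n p.1) (u n p.1) p.2.1 p.2.2)) ?_ fun ω F hF => ?_
  · have hf : Measurable[(M.history N u n).prod inferInstance]
        fun p : Ω × ((EuclideanSpace ℝ (Fin J) × EuclideanSpace ℝ (Fin K)) × (ℝ × ℝ)) => u n p.1 :=
      hun.comp measurable_fst
    have hs : Measurable[(M.history N u n).prod inferInstance]
        fun p : Ω × ((EuclideanSpace ℝ (Fin J) × EuclideanSpace ℝ (Fin K)) × (ℝ × ℝ)) => p.2 :=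
      measurable_snd
    exact ((M.measurable_trueScore hs.fst.fst hf).add
        ((M.measurable_sigmaH.comp hf).mul hs.snd.fst)).prodMk
      ((M.measurable_trueCost hs.fst.snd hf).add ((M.measurable_sigmaT.comp hf).mul hs.snd.snd))
  · have hs : Measurable[(M.history N u n).prod inferInstance] fun p : Ω × (ℝ × ℝ) => p.2 :=
      measurable_snd
    exact Model.measurable_posterior.comp
      (M.measurable_filterStep (hx.comp measurable_fst) (hun.comp measurable_fst) hs.fst hs.snd)
  · exact M.lintegral_posterior_filterStep (Model.posDef_filter n ω).1 (Model.posDef_filter n ω).2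
      (u n ω) hF

theorem disintegrates_posterior (hN : N.IsDriving M P) (hu : M.IsControl N u) (n : ℕ) :
    DisintegratesOver P (M.history N u n) (fun ω => (N.alpha ω, N.beta ω))
      fun ω => Model.posterior (M.filter N u n ω) := by
  induction n with
  | zero =>
    intro A hA B hB
    have hlaw : P ((fun ω => (N.alpha ω, N.beta ω)) ⁻¹' B) =
        Model.posterior ((M.muA, M.SigmaA), (M.muB, M.SigmaB)) B := by
      rw [← Measure.map_apply (hN.measurable_alpha.prodMk hN.measurable_beta) hB,
        (indepFun_iff_map_prod_eq_prod_map_map hN.measurable_alpha.aemeasurable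
          hN.measurable_beta.aemeasurable).1 hN.indep_alpha_beta, hN.law_alpha, hN.law_beta]
      rfl
    rw [Model.history_zero, MeasurableSpace.measurableSet_bot_iff] at hA
    obtain rfl | rfl := hA
    · simp
    · simp only [Set.univ_inter, Model.filter, Measure.restrict_univ, lintegral_const,
        measure_univ, mul_one, hlaw]
  | succ n ih => exact (hN.disintegrates_step hu n ih).2

theorem isCondLaw_posterior (hN : N.IsDriving M P) (hu : M.IsControl N u) (n : ℕ) :
    IsCondLaw P (M.history N u n) (fun ω => (N.alpha ω, N.beta ω))
      fun ω => Model.posterior (M.filter N u n ω) :=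
  (hN.disintegrates_posterior hu n).isCondLaw (hN.history_le hu n)
    (hN.measurable_alpha.prodMk hN.measurable_beta)
    (Model.measurable_posterior.comp (hu.measurable_filter n))

theorem isCondLaw_transition (hN : N.IsDriving M P) (hu : M.IsControl N u) (n : ℕ) :
    IsCondLaw P (M.history N u n) (fun ω => (M.filter N u (n + 1) ω, M.obsCost N u n ω))
      fun ω => M.transition (M.filter N u n ω) (u n ω) := by
  have hle := hN.history_le hu n
  have hx := hu.measurable_filter n
  have hun := hu n
  have hobs := hN.measurable_obs hu n
  have := M.isProbabilityMeasure_transition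
  have hs : Measurable[(M.history N u n).prod inferInstance] fun p : Ω × (ℝ × ℝ) => p.2 :=
    measurable_snd
  have h := (hN.disintegrates_step hu n (hN.disintegrates_posterior hu n)).1.map hle hobs
    (M.measurable_obsLaw.comp (hx.prodMk hun))
    (g := fun p => (M.filterStep (M.filter N u n p.1) (u n p.1) p.2.1 p.2.2, p.2.2))
    ((M.measurable_filterStep (hx.comp measurable_fst) (hun.comp measurable_fst) hs.fst
      hs.snd).prodMk hs.snd)
    (fun ω => M.transition_eq_map_obsLaw (M.filter N u n ω) (u n ω))
  exact h.isCondLaw hle (((hu.measurable_filter (n + 1)).mono (hN.history_le hu _) le_rfl).prodMk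
    hobs.snd) (M.measurable_transition.comp (hx.prodMk hun))

end Noise.IsDriving

end BCT

/-! ### Conditional integrals, extended expectations and stopped rewards -/

namespace BCT

theorem integral_eq_of_disintegrates {Ω S E : Type*} [MeasurableSpace Ω] [MeasurableSpace S]
    [MeasurableSpace E] {P : Measure Ω} [IsFiniteMeasure P] {Y : Ω → S} (hY : Measurable Y)
    {X : Ω → E} (hX : Measurable X) {κ : S → Measure E} (hκ : Measurable κ)
    [∀ s, IsProbabilityMeasure (κ s)]
    (h : ∀ A : Set S, MeasurableSet A → ∀ B : Set E, MeasurableSet B →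
      P (Y ⁻¹' A ∩ X ⁻¹' B) = ∫⁻ ω in Y ⁻¹' A, κ (Y ω) B ∂P)
    {f : S × E → ℝ} (hf : Measurable f) (hfi : Integrable (fun ω => f (Y ω, X ω)) P) :
    ∫ ω, f (Y ω, X ω) ∂P = ∫ ω, ∫ x, f (Y ω, x) ∂κ (Y ω) ∂P := by
  let k : Kernel S E := ⟨κ, hκ⟩
  have : IsMarkovKernel k := ⟨fun s => inferInstanceAs (IsProbabilityMeasure (κ s))⟩
  have key := map_prodMk_eq_compProd hY hX (κ := k) h
  have hint : Integrable f ((P.map Y) ⊗ₘ k) := by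
    rw [← key, integrable_map_measure hf.aestronglyMeasurable (hY.prodMk hX).aemeasurable]
    exact hfi
  rw [← integral_map (f := f) (hY.prodMk hX).aemeasurable hf.aestronglyMeasurable, key,
    Measure.integral_compProd hint, integral_map hY.aemeasurable
      (hf.stronglyMeasurable.integral_kernel_prod_right' (κ := k)).aestronglyMeasurable]
  rfl

namespace DisintegratesOver

variable {Ω E : Type*} {m mΩ : MeasurableSpace Ω} [MeasurableSpace E] {P : Measure Ω}
  [IsFiniteMeasure P] {X : Ω → E} {κ : Ω → Measure E} [∀ ω, IsProbabilityMeasure (κ ω)]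

theorem setIntegral_eq (h : DisintegratesOver P m X κ) (hm : m ≤ mΩ)
    (hX : Measurable X) (hκ : Measurable[m] κ) {f : Ω × E → ℝ}
    (hf : Measurable[m.prod inferInstance] f) (hfi : Integrable (fun ω => f (ω, X ω)) P)
    {A : Set Ω} (hA : MeasurableSet[m] A) :
    ∫ ω in A, f (ω, X ω) ∂P = ∫ ω in A, ∫ x, f (ω, x) ∂κ ω ∂P := by
  have hA' : MeasurableSet[m.prod inferInstance] (Prod.fst ⁻¹' A : Set (Ω × E)) :=
    measurable_fst hA
  have h1 := @integral_eq_of_disintegrates Ω Ω E mΩ m _ P _ id (measurable_id'' hm) X hX κ hκ _ h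
    ((Prod.fst ⁻¹' A).indicator f) (hf.indicator hA') (hfi.indicator (hm _ hA))
  rw [← integral_indicator (hm _ hA), ← integral_indicator (hm _ hA)]
  refine Eq.trans ?_ (h1.trans ?_)
  · rfl
  · congr 1
    ext ω
    by_cases hω : ω ∈ A <;> simp [Set.indicator, hω]

theorem setLIntegral_eq (h : DisintegratesOver P m X κ) (hm : m ≤ mΩ)
    (hX : Measurable X) (hκ : Measurable[m] κ) {f : Ω × E → ℝ≥0∞}
    (hf : Measurable[m.prod inferInstance] f) {A : Set Ω} (hA : MeasurableSet[m] A) :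
    ∫⁻ ω in A, f (ω, X ω) ∂P = ∫⁻ ω in A, ∫⁻ x, f (ω, x) ∂κ ω ∂P := by
  have hA' : MeasurableSet[m.prod inferInstance] (Prod.fst ⁻¹' A : Set (Ω × E)) :=
    measurable_fst hA
  have h1 := h.lintegral_eq hm hX hκ (f := (Prod.fst ⁻¹' A).indicator f) (hf.indicator hA')
  rw [← lintegral_indicator (hm _ hA), ← lintegral_indicator (hm _ hA)]
  refine Eq.trans ?_ (h1.trans ?_)
  · rfl
  · congr 1
    ext ω
    by_cases hω : ω ∈ A <;> simp [Set.indicator, hω]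

end DisintegratesOver

/-- This is Y⁺ − Y⁻ = x⁺ − x⁻ − c for Y = x − c, rearranged without subtraction so that it remains
valid for c = ∞ and can be integrated term by term. -/
theorem toENNReal_sub_add_eq (x : ℝ) (c : ℝ≥0∞) :
    ((x : EReal) - c).toENNReal + ENNReal.ofReal (-x) + c =
      (-((x : EReal) - c)).toENNReal + ENNReal.ofReal x := by
  induction c with
  | top => simp
  | coe c =>
    have h1 : (x : EReal) - ((c : ℝ≥0∞) : EReal) = ((x - c : ℝ) : EReal) := by
      rw [EReal.coe_sub]; rfl
    rw [h1, ← EReal.coe_neg, EReal.toENNReal_of_ne_top (EReal.coe_ne_top _),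
      EReal.toENNReal_of_ne_top (EReal.coe_ne_top _), EReal.toReal_coe, EReal.toReal_coe,
      ← ENNReal.ofReal_coe_nnreal (p := c), ← ENNReal.toReal_eq_toReal_iff' (by simp) (by simp)]
    rw [ENNReal.toReal_add (by simp) (by simp), ENNReal.toReal_add (by simp) (by simp),
      ENNReal.toReal_add (by simp) (by simp)]
    simp only [ENNReal.toReal_ofReal', NNReal.coe_nonneg, sup_of_le_left]
    rcases le_total x 0 with hx | hx <;> rcases le_total (x - c) 0 with hy | hy <;>
      simp [hx, hy] <;> grind

theorem lintegral_toENNReal_sub_ne_top {Ω : Type*} [MeasurableSpace Ω] {P : Measure Ω} {X : Ω → ℝ}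
    (hX : Integrable X P) (C : Ω → ℝ≥0∞) :
    ∫⁻ ω, ((X ω : EReal) - C ω).toENNReal ∂P ≠ ⊤ := by
  refine ne_top_of_le_ne_top hX.lintegral_lt_top.ne (lintegral_mono fun ω => ?_)
  have h : ((X ω : EReal) - C ω) ≤ X ω := by
    simpa using EReal.sub_le_sub (le_refl (X ω : EReal)) (EReal.coe_ennreal_nonneg (C ω))
  refine (EReal.toENNReal_le_toENNReal h).trans ?_
  rw [EReal.toENNReal_of_ne_top (EReal.coe_ne_top _), EReal.toReal_coe]

/-- In the integrated identity the positive part of the difference and both parts of `X` are finite.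
Hence the negative part has infinite integral exactly when `C` does, and otherwise the identity can
be solved in ℝ. -/
theorem extExpectation_sub {Ω : Type*} [MeasurableSpace Ω] {P : Measure Ω} {X : Ω → ℝ}
    (hX : Integrable X P) {C : Ω → ℝ≥0∞} (hC : Measurable C) :
    extExpectation P (fun ω => (X ω : EReal) - C ω) =
      ((∫ ω, X ω ∂P : ℝ) : EReal) - ((∫⁻ ω, C ω ∂P : ℝ≥0∞) : EReal) := by
  have hX' := hX.aestronglyMeasurable.aemeasurable
  have hXn : AEMeasurable (fun ω => ENNReal.ofReal (-X ω)) P := hX'.neg.ennreal_ofReal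
  have hfin := lintegral_toENNReal_sub_ne_top hX C
  have h := lintegral_congr (μ := P) fun ω => toENNReal_sub_add_eq (X ω) (C ω)
  rw [lintegral_add_right _ hC, lintegral_add_right' _ hXn,
    lintegral_add_right' _ hX'.ennreal_ofReal] at h
  rw [integral_eq_lintegral_pos_part_sub_lintegral_neg_part hX, extExpectation]
  have hp := hX.lintegral_lt_top.ne
  have hn : ∫⁻ ω, ENNReal.ofReal (-X ω) ∂P ≠ ⊤ := hX.neg.lintegral_lt_top.ne
  generalize ∫⁻ ω, ((X ω : EReal) - C ω).toENNReal ∂P = a at *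
  generalize ∫⁻ ω, (-((X ω : EReal) - C ω)).toENNReal ∂P = b at *
  generalize ∫⁻ ω, ENNReal.ofReal (X ω) ∂P = p at *
  generalize ∫⁻ ω, ENNReal.ofReal (-X ω) ∂P = q at *
  generalize ∫⁻ ω, C ω ∂P = c at *
  lift a to NNReal using hfin
  lift p to NNReal using hp
  lift q to NNReal using hn
  induction c with
  | top =>
    have hb : b = ⊤ := by
      by_contra hb
      lift b to NNReal using hb
      rw [add_top] at h
      exact absurd h.symm (by simp)
    simp [hb]
  | coe c =>
    have hb : b ≠ ⊤ := by
      rintro rfl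
      rw [top_add] at h
      exact absurd h (by simp)
    lift b to NNReal using hb
    have h' : (a + q + c : ℝ) = b + p := by exact_mod_cast h
    have e : ∀ r : NNReal, (((r : ℝ≥0∞)) : EReal) = ((r : ℝ) : EReal) := fun r => rfl
    rw [e, e, e, ← EReal.coe_sub, ← EReal.coe_sub]
    congr 1
    simp only [ENNReal.coe_toReal]
    linarith

section Stopped

variable {Ω : Type*} {τ : Ω → ℕ∞} {R : ℕ → Ω → ℝ}

theorem pairwise_disjoint_stopped :
    Pairwise (Function.onFun Disjoint fun n : ℕ => {ω | τ ω = (n : ℕ∞)}) := by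
  intro i j hij
  refine Set.disjoint_left.2 fun ω hi hj => hij ?_
  have : (i : ℕ∞) = j := hi.symm.trans hj
  exact_mod_cast this

theorem stopped_eq_zero {ω : Ω} (hω : ω ∉ ⋃ n : ℕ, {ω | τ ω = (n : ℕ∞)}) :
    (if τ ω = ⊤ then 0 else R (τ ω).toNat ω) = 0 := by
  rcases h : τ ω with _ | n
  · rfl
  · exact absurd (Set.mem_iUnion.2 ⟨n, h⟩) hω

variable [MeasurableSpace Ω] {P : Measure Ω}

theorem measurable_stopped (hτ : ∀ n : ℕ, MeasurableSet {ω | τ ω = (n : ℕ∞)})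
    (hR : ∀ n, Measurable (R n)) :
    Measurable fun ω => if τ ω = ⊤ then 0 else R (τ ω).toNat ω := by
  intro B hB
  have e : (fun ω => if τ ω = ⊤ then 0 else R (τ ω).toNat ω) ⁻¹' B =
      (⋃ n : ℕ, {ω | τ ω = (n : ℕ∞)} ∩ R n ⁻¹' B) ∪
        ((⋃ n : ℕ, {ω | τ ω = (n : ℕ∞)})ᶜ ∩ (fun _ => (0 : ℝ)) ⁻¹' B) := by
    ext ω
    rcases h : τ ω with _ | n
    · have : τ ω = ⊤ := h
      simp [this]
    · have : τ ω = (n : ℕ∞) := h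
      simp [this]
  rw [e]
  exact (MeasurableSet.iUnion fun n => (hτ n).inter (hR n hB)).union
    ((MeasurableSet.iUnion hτ).compl.inter (measurable_const hB))

/-- The events {τ = n} are disjoint, and off their union the stopped reward is 0 by convention. -/
theorem lintegral_enorm_stopped (hτ : ∀ n : ℕ, MeasurableSet {ω | τ ω = (n : ℕ∞)}) :
    ∫⁻ ω, ‖if τ ω = ⊤ then 0 else R (τ ω).toNat ω‖ₑ ∂P =
      ∑' n : ℕ, ∫⁻ ω in {ω | τ ω = (n : ℕ∞)}, ‖R n ω‖ₑ ∂P := by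
  rw [← setLIntegral_eq_of_support_subset (s := ⋃ n : ℕ, {ω | τ ω = (n : ℕ∞)}),
    lintegral_iUnion hτ pairwise_disjoint_stopped]
  · refine tsum_congr fun n => setLIntegral_congr_fun (hτ n) fun ω hω => ?_
    have hω : τ ω = n := hω
    simp [hω]
  · intro ω hω
    by_contra h
    exact hω (by simp only [stopped_eq_zero h, enorm_zero])

theorem integral_stopped (hτ : ∀ n : ℕ, MeasurableSet {ω | τ ω = (n : ℕ∞)})
    (hi : Integrable (fun ω => if τ ω = ⊤ then 0 else R (τ ω).toNat ω) P) :
    ∫ ω, (if τ ω = ⊤ then 0 else R (τ ω).toNat ω) ∂P =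
      ∑' n : ℕ, ∫ ω in {ω | τ ω = (n : ℕ∞)}, R n ω ∂P := by
  rw [← setIntegral_eq_integral_of_forall_compl_eq_zero
      (s := ⋃ n : ℕ, {ω | τ ω = (n : ℕ∞)}) fun ω hω => stopped_eq_zero hω,
    integral_iUnion hτ pairwise_disjoint_stopped hi.integrableOn]
  refine tsum_congr fun n => setIntegral_congr_fun (hτ n) fun ω hω => ?_
  have hω : τ ω = n := hω
  simp [hω]

end Stopped

end BCT

/-! ### Equality of the expected pay-offs -/

namespace BCT

variable {Ω U : Type*} [mΩ : MeasurableSpace Ω] [MeasurableSpace U] {J K : ℕ} {M : Model U J K}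
  {N : Noise Ω J K} {P : Measure Ω} {u : ℕ → Ω → U} {τ : Ω → ℕ∞}

theorem Model.exists_abs_trueScore_le (M : Model U J K) :
    ∃ C : ℝ, ∀ a u, |M.trueScore a u| ≤ C * ‖a‖ := by
  obtain ⟨C, hC⟩ := M.bounded_phi
  refine ⟨∑ _ : Fin J, C, fun a u => ?_⟩
  rw [Finset.sum_mul]
  refine (Finset.abs_sum_le_sum_abs _ _).trans (Finset.sum_le_sum fun j _ => ?_)
  rw [abs_mul, mul_comm]
  exact mul_le_mul (hC j u) (PiLp.norm_apply_le a j) (abs_nonneg _) ((abs_nonneg _).trans (hC j u))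

theorem Model.integral_trueScore_posterior (M : Model U J K) (x : FilterState J K) (u : U) :
    ∫ q, M.trueScore q.1 u ∂Model.posterior x = x.1.1.ofLp ⬝ᵥ M.phiVec u := by
  have hint : Integrable (fun a => a) (multivariateGaussian x.1.1 x.1.2) :=
    IsGaussian.integrable_fun_id
  have h1 : ∀ j : Fin J, Integrable (fun a => a j) (multivariateGaussian x.1.1 x.1.2) := fun j =>
    (EuclideanSpace.proj (𝕜 := ℝ) j).integrable_comp hint
  have h2 : ∀ j : Fin J, ∫ a, a j ∂multivariateGaussian x.1.1 x.1.2 = x.1.1 j := fun j => by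
    have := (EuclideanSpace.proj (𝕜 := ℝ) j).integral_comp_comm hint
    rw [integral_id_multivariateGaussian] at this
    exact this
  unfold Model.posterior
  rw [integral_fun_fst (fun a => M.trueScore a u)]
  simp only [Model.trueScore, probReal_univ, one_smul]
  rw [integral_finsetSum _ fun j _ => (h1 j).mul_const _]
  simp only [integral_mul_const, h2]
  rfl

theorem Noise.IsDriving.integrable_norm_alpha (hN : N.IsDriving M P) :
    Integrable (fun ω => ‖N.alpha ω‖) P := by
  have h : Integrable id (P.map N.alpha) := by
    rw [hN.law_alpha]; exact IsGaussian.integrable_id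
  exact ((integrable_map_measure aestronglyMeasurable_id hN.measurable_alpha.aemeasurable).1 h).norm

namespace Model.IsAdmissible

theorem measurableSet_stop_eq (hu : M.IsAdmissible N u τ) (hN : N.IsDriving M P) (n : ℕ) :
    MeasurableSet {ω | τ ω = (n : ℕ∞)} :=
  hN.history_le hu.1 n _ (hu.2.1 n)

theorem measurable_cost (hu : M.IsAdmissible N u τ) (hN : N.IsDriving M P) :
    Measurable fun ω => ENNReal.ofReal M.gamma * ∑' n : ℕ,
      (if ((n + 1 : ℕ) : ℕ∞) ≤ τ ω then ENNReal.ofReal (M.obsCost N u n ω) else 0) := by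
  refine (Measurable.tsum fun n => Measurable.ite ?_
    (hN.measurable_obs hu.1 n).snd.ennreal_ofReal measurable_const).const_mul _
  -- The event n + 1 ≤ τ is the complement of finitely many events {τ = i}, i ≤ n, and so also
  -- covers τ = ∞.
  have e : {ω | ((n + 1 : ℕ) : ℕ∞) ≤ τ ω} =
      (⋃ i ∈ Finset.range (n + 1), {ω | τ ω = (i : ℕ∞)})ᶜ := by
    ext ω
    rcases h : τ ω with _ | k
    · have : τ ω = ⊤ := h
      simp [this]
    · have : τ ω = (k : ℕ∞) := h
      simp only [this, Set.mem_ofPred_eq, Nat.cast_le, Set.mem_compl_iff, Set.mem_iUnion,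
        Finset.mem_range, Nat.cast_inj, exists_prop, not_exists, not_and]
      exact ⟨fun h i hi hk => by omega, fun h => by by_contra hc; exact h k (by omega) rfl⟩
  rw [e]
  exact (Finset.measurableSet_biUnion _ fun i _ => hu.measurableSet_stop_eq hN i).compl

theorem measurable_trueReward (hu : M.IsAdmissible N u τ) (hN : N.IsDriving M P) (n : ℕ) :
    Measurable fun ω => M.trueScore (N.alpha ω) (u (n - 1) ω) :=
  M.measurable_trueScore hN.measurable_alpha
    ((hu.measurable_control_pred n).mono (hN.history_le hu.1 n) le_rfl)

theorem measurable_filteredReward (hu : M.IsAdmissible N u τ) (hN : N.IsDriving M P) (n : ℕ) :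
    Measurable fun ω => (M.filter N u n ω).1.1.ofLp ⬝ᵥ M.phiVec (u (n - 1) ω) := by
  have hle := hN.history_le hu.1 n
  have h := M.measurable_trueScore (((hu.1.measurable_filter n).mono hle le_rfl).fst.fst)
    ((hu.measurable_control_pred n).mono hle le_rfl)
  exact h

theorem integrable_trueReward (hu : M.IsAdmissible N u τ) (hN : N.IsDriving M P) (n : ℕ) :
    Integrable (fun ω => M.trueScore (N.alpha ω) (u (n - 1) ω)) P := by
  obtain ⟨C, hC⟩ := M.exists_abs_trueScore_le
  exact (hN.integrable_norm_alpha.const_mul C).mono'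
    (hu.measurable_trueReward hN n).aestronglyMeasurable
    (Filter.Eventually.of_forall fun ω => hC _ _)

theorem integrable_stopped_trueReward (hu : M.IsAdmissible N u τ) (hN : N.IsDriving M P) :
    Integrable (fun ω => if τ ω = ⊤ then 0 else
      M.trueScore (N.alpha ω) (u ((τ ω).toNat - 1) ω)) P := by
  obtain ⟨C, hC⟩ := M.exists_abs_trueScore_le
  refine (hN.integrable_norm_alpha.const_mul C).mono'
    (measurable_stopped (R := fun n ω => M.trueScore (N.alpha ω) (u (n - 1) ω))
      (hu.measurableSet_stop_eq hN) (hu.measurable_trueReward hN)).aestronglyMeasurable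
    (Filter.Eventually.of_forall fun ω => ?_)
  split_ifs
  · rw [norm_zero]
    -- The sign of C is not recorded, so C‖α‖ ≥ 0 is read off from the bound at an arbitrary control
    -- value.
    exact (abs_nonneg _).trans (hC (N.alpha ω) (u 0 ω))
  · exact hC _ _

variable [IsProbabilityMeasure P]

/-- The tower property: on an event of the history at time n, the score at the known control u_{n-1}
may be replaced by its posterior mean. -/
theorem setIntegral_reward_eq (hu : M.IsAdmissible N u τ) (hN : N.IsDriving M P) (n : ℕ) :
    ∫ ω in {ω | τ ω = (n : ℕ∞)}, M.trueScore (N.alpha ω) (u (n - 1) ω) ∂P =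
      ∫ ω in {ω | τ ω = (n : ℕ∞)}, (M.filter N u n ω).1.1.ofLp ⬝ᵥ M.phiVec (u (n - 1) ω) ∂P := by
  have h := (hN.disintegrates_posterior hu.1 n).setIntegral_eq (hN.history_le hu.1 n)
    (hN.measurable_alpha.prodMk hN.measurable_beta)
    (measurable_posterior.comp (hu.1.measurable_filter n)) (hu.measurable_score_pred n)
    (hu.integrable_trueReward hN n) (hu.2.1 n)
  rw [h]
  simp only [M.integral_trueScore_posterior]

/-- The absolute value of a posterior mean is at most the posterior mean of the absolute value.
Summed over n, this transfers integrability from the true to the filtered stopped reward. -/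
theorem setLIntegral_enorm_filteredReward_le (hu : M.IsAdmissible N u τ) (hN : N.IsDriving M P)
    (n : ℕ) :
    ∫⁻ ω in {ω | τ ω = (n : ℕ∞)},
        ‖(M.filter N u n ω).1.1.ofLp ⬝ᵥ M.phiVec (u (n - 1) ω)‖ₑ ∂P ≤
      ∫⁻ ω in {ω | τ ω = (n : ℕ∞)}, ‖M.trueScore (N.alpha ω) (u (n - 1) ω)‖ₑ ∂P := by
  have h := (hN.disintegrates_posterior hu.1 n).setLIntegral_eq (hN.history_le hu.1 n)
    (hN.measurable_alpha.prodMk hN.measurable_beta)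
    (measurable_posterior.comp (hu.1.measurable_filter n)) (measurable_enorm.comp (hu.measurable_score_pred n))
    (hu.2.1 n)
  refine le_trans (lintegral_mono fun ω => ?_) h.ge
  rw [← M.integral_trueScore_posterior]
  exact enorm_integral_le_lintegral_enorm _

theorem integrable_stopped_filteredReward (hu : M.IsAdmissible N u τ) (hN : N.IsDriving M P) :
    Integrable (fun ω => if τ ω = ⊤ then 0 else
      (M.filter N u (τ ω).toNat ω).1.1.ofLp ⬝ᵥ M.phiVec (u ((τ ω).toNat - 1) ω)) P := by
  refine ⟨(measurable_stopped
    (R := fun n ω => (M.filter N u n ω).1.1.ofLp ⬝ᵥ M.phiVec (u (n - 1) ω))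
    (hu.measurableSet_stop_eq hN) (hu.measurable_filteredReward hN)).aestronglyMeasurable, ?_⟩
  refine lt_of_le_of_lt ?_ (hu.integrable_stopped_trueReward hN).hasFiniteIntegral
  rw [lintegral_enorm_stopped
      (R := fun n ω => (M.filter N u n ω).1.1.ofLp ⬝ᵥ M.phiVec (u (n - 1) ω))
      (hu.measurableSet_stop_eq hN),
    lintegral_enorm_stopped (R := fun n ω => M.trueScore (N.alpha ω) (u (n - 1) ω))
      (hu.measurableSet_stop_eq hN)]
  exact ENNReal.tsum_le_tsum fun n => hu.setLIntegral_enorm_filteredReward_le hN n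

theorem integral_stopped_reward_eq (hu : M.IsAdmissible N u τ) (hN : N.IsDriving M P) :
    ∫ ω, (if τ ω = ⊤ then 0 else M.trueScore (N.alpha ω) (u ((τ ω).toNat - 1) ω)) ∂P =
      ∫ ω, (if τ ω = ⊤ then 0 else
        (M.filter N u (τ ω).toNat ω).1.1.ofLp ⬝ᵥ M.phiVec (u ((τ ω).toNat - 1) ω)) ∂P := by
  rw [integral_stopped (R := fun n ω => M.trueScore (N.alpha ω) (u (n - 1) ω))
      (hu.measurableSet_stop_eq hN) (hu.integrable_stopped_trueReward hN),
    integral_stopped (R := fun n ω => (M.filter N u n ω).1.1.ofLp ⬝ᵥ M.phiVec (u (n - 1) ω))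
      (hu.measurableSet_stop_eq hN) (hu.integrable_stopped_filteredReward hN)]
  exact tsum_congr fun n => hu.setIntegral_reward_eq hN n

theorem extExpectation_payoff_eq (hu : M.IsAdmissible N u τ) (hN : N.IsDriving M P) :
    extExpectation P (M.truePayoff N u τ) = extExpectation P (M.filteredPayoff N u τ) := by
  refine (extExpectation_sub (hu.integrable_stopped_trueReward hN) (hu.measurable_cost hN)).trans ?_
  rw [hu.integral_stopped_reward_eq hN]
  exact (extExpectation_sub (hu.integrable_stopped_filteredReward hN) (hu.measurable_cost hN)).symm

end Model.IsAdmissible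

end BCT

theorem mainTheorem1 {Ω U : Type*} [MeasurableSpace Ω] [MeasurableSpace U] {J K : ℕ}
    (M : BCT.Model U J K) (N : BCT.Noise Ω J K) (P : MeasureTheory.Measure Ω)
    [MeasureTheory.IsProbabilityMeasure P] (hN : N.IsDriving M P) :
    -- the partially observed problem and the problem in terms of the filter have the same value
    M.trueValue N P = M.filteredValue N P ∧
    -- more precisely, each admissible strategy has the same well-defined expected pay-off in both
    (∀ (u : ℕ → Ω → U) (τ : Ω → ℕ∞), M.IsAdmissible N u τ →
      ∫⁻ ω, (M.truePayoff N u τ ω).toENNReal ∂P ≠ ⊤ ∧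
      ∫⁻ ω, (M.filteredPayoff N u τ ω).toENNReal ∂P ≠ ⊤ ∧
      BCT.extExpectation P (M.truePayoff N u τ) =
        BCT.extExpectation P (M.filteredPayoff N u τ)) ∧
    -- the Kalman filter is observable and gives the conditional distribution of `(α, β)`
    (∀ u : ℕ → Ω → U, M.IsControl N u → ∀ n : ℕ,
      Measurable[M.history N u n] (M.filter N u n) ∧
      (∀ ω, (M.filter N u n ω).1.2.PosDef ∧ (M.filter N u n ω).2.2.PosDef) ∧
      BCT.IsCondLaw P (M.history N u n) (fun ω => (N.alpha ω, N.beta ω))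
        (fun ω => (ProbabilityTheory.multivariateGaussian
            (M.filter N u n ω).1.1 (M.filter N u n ω).1.2).prod
          (ProbabilityTheory.multivariateGaussian
            (M.filter N u n ω).2.1 (M.filter N u n ω).2.2))) ∧
    -- the filter parameters and the cost form a time-homogeneous controlled Markov process
    (Measurable (fun p : BCT.FilterState J K × U => M.transition p.1 p.2) ∧
      (∀ x u, MeasureTheory.IsProbabilityMeasure (M.transition x u)) ∧
      ∀ u : ℕ → Ω → U, M.IsControl N u → ∀ n : ℕ,
        BCT.IsCondLaw P (M.history N u n)
          (fun ω => (M.filter N u (n + 1) ω, M.obsCost N u n ω))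
          (fun ω => M.transition (M.filter N u n ω) (u n ω))) := by
  refine ⟨?_, fun u τ hu => ⟨?_, ?_, hu.extExpectation_payoff_eq hN⟩, fun u hu n =>
    ⟨hu.measurable_filter n, BCT.Model.posDef_filter n, hN.isCondLaw_posterior hu n⟩,
    M.measurable_transition, M.isProbabilityMeasure_transition, fun u hu n =>
    hN.isCondLaw_transition hu n⟩
  · exact iSup_congr fun u => iSup_congr fun τ => iSup_congr fun hu =>
      hu.extExpectation_payoff_eq hN
  · exact BCT.lintegral_toENNReal_sub_ne_top (hu.integrable_stopped_trueReward hN) _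
  · exact BCT.lintegral_toENNReal_sub_ne_top (hu.integrable_stopped_filteredReward hN) _
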